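/- Let $\ell\ge 1$ and let $\Gamma_1,\dots,\Gamma_{2\ell+1}$ be the Clifford matrices on $(\mathbb C^2)^{\otimes \ell}$: for $\ell=1$ they are the Pauli matrices $X,Y,Z$, and for $\ell>1$ they are $X\otimes\Gamma'_i$ ($1\le i\le 2\ell-1$, with $\Gamma'_i$ the Clifford matrices for $\ell-1$), $Y\otimes \mathbb 1$, $Z\otimes\mathbb 1$. Put $\Gamma^{ab}=-i\,\Gamma_a\Gamma_b$ for $a\ne b$. The $SO(2\ell+1)$ AKLT state with on-site adjoint irrep (dimension $\ell(2\ell+1)$) and virtual spinor irrep (dimension $2^\ell$) is the matrix product state $\sum_{i_1,\dots,i_n}\langle R|A_{i_1}\cdots A_{i_n}|L\rangle\,|i_1\dots i_n\rangle$ with Kraus operators $A_{ab}=\Gamma^{ab}/\sqrt{\ell(2\ell+1)}$, $a<b$. For $g\in SO(2\ell+1)$ let $U(g)$ be the adjoint representation matrix, $U(g)_{ab,mn}=g_{am}g_{bn}-g_{an}g_{bm}$ ($a<b$, $m<n$). Measuring a site in the basis rotated by $U(g)$, $\langle w_i|=\sum_j U(g)_{ij}\langle j|$, with outcome $i$ enacts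 $\tilde A_i=\sum_j U(g)_{ij}A_j$ on the virtual space. If the sites $1,\dots,n$ are measured in the bases rotated by $U(g_1),\dots,U(g_n)$ with outcomes $i_1,\dots,i_n$, the gate induced is the operator $G$ for which the enacted operator $\tilde A_{i_1}\cdots\tilde A_{i_n}$ equals $(\ell(2\ell+1))^{-n/2}\,\Gamma^{i_1}\cdots\Gamma^{i_n}\,G$; the factor $\Gamma^{i_1}\cdots\Gamma^{i_n}$ is the byproduct. Then: 1. The Kraus operators satisfy $\sum_{a<b}A_{ab}^\dagger A_{ab}=\mathbb 1$. The matrices $U(g)$ form an irreducible unitary representation of $SO(2\ell+1)$. 2. (Gates.) Every measurement record induces a unitary gate, and the set $\mathcal G$ of all induced gates (over all $n$, all $g_k$ and all outcomes) is a subgroup of $U(2^\ell)$, namely the group generated by the unitaries $e^{-i\theta\Gamma^{ab}}$ ($a\neq b$, $\theta\in\mathbb R$). It acts irreducibly on the virtual space. Modulo global phases it is $SO(2\ell+1)$: there is a homomorphism $\pi:\mathcal G\to SO(2\ell+1)$ that is surjective and a topological quotient map, whose kernel is the set of scalar matrices in $\mathcal G$, which is $\{\pm \mathbb 1\}$, and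 which satisfies the symmetry condition $\sum_j U(\pi(V))_{ij}A_j=V^\dagger A_iV$ for all $V\in\mathcal G$ and all $i$. 3. (Success probability.) Let $a\ne b$ and $\theta\in\mathbb R$ be such that $e^{-i\theta\Gamma^{ab}}$ is not a scalar matrix. Measure one site in the basis rotated by $U(\pi(V))$ with $V=e^{-i\theta\Gamma^{ab}/2}\in\mathcal G$. Then each outcome $i$ enacts either $A_i\,e^{-i\theta\Gamma^{ab}}$ (success) or $A_i$ (the identity gate up to byproduct), and for every unit vector of the virtual space the probability of success is $$p=\frac{2(2\ell-1)}{\ell(2\ell+1)}.$$ The same holds for projections on the virtual space: for all $a\ne b$ there are an orthonormal on-site measurement basis and a set $S$ of outcomes such that each outcome in $S$ enacts, up to a nonzero factor, a Pauli operator (a tensor product of $\mathbb 1,X,Y,Z$ up to a phase in $\{\pm1,\pm i\}$) times one of the projectors $(\mathbb 1\pm\Gamma^{ab})/2$, every outcome $i\notin S$ enacts $A_i$, and for every unit vector of the virtual space the probability of $S$ is $p$. 4. (Byproducts.) The operators $\Gamma_a\Gamma_b$ ($a\ne b$), and all byproducts $\Gamma^{i_1}\cdots\Gamma^{i_n}$,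 are tensor products of Pauli operators $\mathbb 1,X,Y,Z$ up to a phase in $\{\pm1,\pm i\}$. -/

import Mathlib

noncomputable section

namespace AKLT

open Matrix

/-! ### Matrix product states and local measurements -/

/-- The amplitudes `⟨R| A_{i₁} ⋯ A_{iₙ} |L⟩` of the matrix product state with site tensor `A` on
`n` sites, with open boundary vectors `R`, `L` in the virtual space. -/
def mpsState {ι κ : Type} [Fintype κ] [DecidableEq κ] (A : ι → Matrix κ κ ℂ) (n : ℕ)
    (R L : κ → ℂ) : (Fin n → ι) → ℂ :=
  fun i => star R ⬝ᵥ ((List.ofFn fun k => A (i k)).prod *ᵥ L)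

/-- The amplitude of the outcomes `i` when site `k` of the state `Ψ` is measured in the basis
`⟨w_s| = ∑ⱼ (W k)_{sj} ⟨j|`. -/
def measuredAmplitude {ι : Type} [Fintype ι] {n : ℕ} (W : Fin n → Matrix ι ι ℂ)
    (i : Fin n → ι) (Ψ : (Fin n → ι) → ℂ) : ℂ :=
  ∑ j : Fin n → ι, (∏ k, W k (i k) (j k)) * Ψ j

/-- The operator `∑ⱼ w_{ij} A_j` enacted on the virtual space by the outcome `i` of a measurement of
one site in the basis rotated by `W`. -/
def rotatedKraus {ι κ : Type} [Fintype ι] (A : ι → Matrix κ κ ℂ) (W : Matrix ι ι ℂ) (i : ι) :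
    Matrix κ κ ℂ :=
  ∑ j, W i j • A j

/-- The squared Hilbert space norm. -/
def normSq {κ : Type} [Fintype κ] (ψ : κ → ℂ) : ℝ := ∑ x, ‖ψ x‖ ^ 2

open Classical in
/-- The Born probability that the measurement of one site in the basis rotated by `W`, with the
virtual system in the state `ψ`, has an outcome in the event `S`. -/
def eventProb {ι κ : Type} [Fintype ι] [Fintype κ] (A : ι → Matrix κ κ ℂ) (W : Matrix ι ι ℂ)
    (ψ : κ → ℂ) (S : Set ι) : ℝ :=
  ∑ i, if i ∈ S then normSq (rotatedKraus A W i *ᵥ ψ) else 0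

/-- A set of matrices acts irreducibly on `κ → ℂ`: the space is nonzero and the only invariant
subspaces are the trivial ones. -/
def ActsIrreducibly {κ : Type} [Fintype κ] (S : Set (Matrix κ κ ℂ)) : Prop :=
  Nonempty κ ∧ ∀ E : Submodule ℂ (κ → ℂ),
    (∀ M ∈ S, ∀ v ∈ E, M *ᵥ v ∈ E) → E = ⊥ ∨ E = ⊤

/-! ### Pauli operators and Clifford matrices on `ℓ` qubits -/

/-- Basis labels of `ℓ` qubits. -/
abbrev Qubits (ℓ : ℕ) : Type := Fin ℓ → Fin 2

/-- The matrices `𝟙, X, Y, Z`. -/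
def pauli : Fin 4 → Matrix (Fin 2) (Fin 2) ℂ :=
  ![1, !![0, 1; 1, 0], !![0, -Complex.I; Complex.I, 0], !![1, 0; 0, -1]]

/-- The tensor product of one-qubit operators `pauli (s 0) ⊗ pauli (s 1) ⊗ ⋯`. -/
def pauliString {ℓ : ℕ} (s : Fin ℓ → Fin 4) : Matrix (Qubits ℓ) (Qubits ℓ) ℂ :=
  of fun x y => ∏ k, pauli (s k) (x k) (y k)

/-- A tensor product of Pauli operators, up to a phase `1, i, -1, -i`. -/
def IsPauliOp {ℓ : ℕ} (M : Matrix (Qubits ℓ) (Qubits ℓ) ℂ) : Prop :=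
  ∃ (u : ℂ) (s : Fin ℓ → Fin 4), u ^ 4 = 1 ∧ M = u • pauliString s

/-- `P ⊗ M` for an operator `P` on one qubit and `M` on `ℓ` further qubits. -/
def qubitTensor {ℓ : ℕ} (P : Matrix (Fin 2) (Fin 2) ℂ) (M : Matrix (Qubits ℓ) (Qubits ℓ) ℂ) :
    Matrix (Qubits (ℓ + 1)) (Qubits (ℓ + 1)) ℂ :=
  of fun x y => P (x 0) (y 0) * M (Fin.tail x) (Fin.tail y)

/-- The Clifford matrices, indexed from `0`: for `ℓ + 1` qubits they are `X ⊗ Γ'ᵢ` for the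
`2ℓ + 1` Clifford matrices `Γ'ᵢ` on `ℓ` qubits, followed by `Y ⊗ 𝟙` and `Z ⊗ 𝟙`. For one qubit
this gives `X, Y, Z`. -/
def cliffordAux : (ℓ : ℕ) → ℕ → Matrix (Qubits ℓ) (Qubits ℓ) ℂ
  | 0, _ => 1
  | ℓ + 1, i =>
    if i < 2 * ℓ + 1 then qubitTensor (pauli 1) (cliffordAux ℓ i)
    else if i = 2 * ℓ + 1 then qubitTensor (pauli 2) 1
    else qubitTensor (pauli 3) 1

/-- The Clifford matrices `Γ_a`, `a = 0, …, 2ℓ`. -/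
def gamma (ℓ : ℕ) (a : Fin (2 * ℓ + 1)) : Matrix (Qubits ℓ) (Qubits ℓ) ℂ := cliffordAux ℓ a

/-- The generators `Γ^{ab} = -i Γ_a Γ_b` of `so(2ℓ+1)` in the spinor representation
(used for `a ≠ b`). -/
def gammaPair {ℓ : ℕ} (a b : Fin (2 * ℓ + 1)) : Matrix (Qubits ℓ) (Qubits ℓ) ℂ :=
  -Complex.I • (gamma ℓ a * gamma ℓ b)

/-- The unitary `exp(-i θ Γ^{ab})`. -/
def expGate {ℓ : ℕ} (a b : Fin (2 * ℓ + 1)) (θ : ℝ) : Matrix (Qubits ℓ) (Qubits ℓ) ℂ :=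
  NormedSpace.exp ((-Complex.I * (θ : ℂ)) • gammaPair a b)

/-! ### The `SO(2ℓ+1)` AKLT state with on-site adjoint representation -/

/-- The group `SO(2ℓ+1)`. -/
abbrev SO (ℓ : ℕ) : Type := specialOrthogonalGroup (Fin (2 * ℓ + 1)) ℝ

/-- Labels `(a, b)`, `a < b`, of the on-site basis. -/
abbrev Pair (ℓ : ℕ) : Type := {p : Fin (2 * ℓ + 1) × Fin (2 * ℓ + 1) // p.1 < p.2}

/-- The Pauli-type operator `Γ^{ab}` with `a < b`. -/
def pairOp {ℓ : ℕ} (p : Pair ℓ) : Matrix (Qubits ℓ) (Qubits ℓ) ℂ := gammaPair p.1.1 p.1.2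

/-- The adjoint representation of `SO(2ℓ+1)`, i.e. `X ↦ g X gᵀ` on antisymmetric matrices, in the
basis `E_{ab} - E_{ba}`, `a < b`. -/
def adjoint {ℓ : ℕ} (g : SO ℓ) : Matrix (Pair ℓ) (Pair ℓ) ℂ :=
  of fun p q =>
    ((g.1 p.1.1 q.1.1 * g.1 p.1.2 q.1.2 - g.1 p.1.1 q.1.2 * g.1 p.1.2 q.1.1 : ℝ) : ℂ)

/-- The normalization `1 / √(ℓ(2ℓ+1))` of the Kraus operators. -/
def krausNorm (ℓ : ℕ) : ℝ := 1 / Real.sqrt ((ℓ : ℝ) * (2 * ℓ + 1))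

/-- The Kraus operators `Γ^{ab} / √(ℓ(2ℓ+1))`, `a < b`, of the AKLT state. -/
def akltTensor (ℓ : ℕ) (p : Pair ℓ) : Matrix (Qubits ℓ) (Qubits ℓ) ℂ :=
  (krausNorm ℓ : ℂ) • pairOp p

/-- The `SO(2ℓ+1)` AKLT state on `n` sites with open boundary vectors `R`, `L`. -/
def akltState (ℓ n : ℕ) (R L : Qubits ℓ → ℂ) : (Fin n → Pair ℓ) → ℂ :=
  mpsState (akltTensor ℓ) n R L

/-! ### Gates induced by symmetry-rotated measurements -/

/-- The byproduct `Γ^{i₁} ⋯ Γ^{iₙ}` of the outcomes `i₁, …, iₙ`. -/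
def byproduct {ℓ n : ℕ} (i : Fin n → Pair ℓ) : Matrix (Qubits ℓ) (Qubits ℓ) ℂ :=
  (List.ofFn fun k => pairOp (i k)).prod

/-- Measuring site `k` of the AKLT state in the basis rotated by the on-site symmetry operation
`adjoint (g k)`, with outcomes `i`, induces on the virtual space the gate `G` up to the byproduct
of the outcomes: for all boundary vectors the projected state is `⟨R| (byproduct) G |L⟩`, up to the
normalization of the Kraus operators. -/
def Induces {ℓ n : ℕ} (g : Fin n → SO ℓ) (i : Fin n → Pair ℓ)
    (G : Matrix (Qubits ℓ) (Qubits ℓ) ℂ) : Prop :=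
  ∀ R L : Qubits ℓ → ℂ,
    measuredAmplitude (fun k => adjoint (g k)) i (akltState ℓ n R L)
      = (krausNorm ℓ : ℂ) ^ n * (star R ⬝ᵥ ((byproduct i * G) *ᵥ L))

/-- The set of all gates on the virtual space induced by finitely many on-site projective
measurements in symmetry-rotated bases. -/
def inducedGates (ℓ : ℕ) : Set (Matrix (Qubits ℓ) (Qubits ℓ) ℂ) :=
  {G | ∃ (n : ℕ) (g : Fin n → SO ℓ) (i : Fin n → Pair ℓ), Induces g i G}

/-- The claimed success probability. -/
def successProb (ℓ : ℕ) : ℝ := 2 * (2 * (ℓ : ℝ) - 1) / ((ℓ : ℝ) * (2 * ℓ + 1))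

end AKLT

end

/-!
The Clifford matrices are anticommuting Hermitian square roots of `1`, and products of an even
number of them span all matrices on the virtual space. Conjugation by `exp (-iθΓ^{ab}/2)` rotates
`Γ_a, Γ_b` in their plane and fixes the other `Γ_c`, and such plane rotations generate
`SO(2ℓ+1)`; this gives `π` on the group generated by the `exp (-iθΓ^{ab})`. An element of its
kernel commutes with every `Γ_a`, so it is a scalar `z`, and since the group preserves the bilinear
form of the charge conjugation matrix `C` (for which `C Γ_a = ± Γ_aᵀ C`), `z² = 1`. The group is
moreover closed: it is the group of all unitaries that preserve this form and normalize the real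
span of the `Γ_a`. So `π` is a continuous surjection from a compact group.

A measurement rotated by `π(V)` enacts `V† A_i V`. If `{m, n}` meets `{a, b}` in exactly one
index, then `Γ^{ab}` and `Γ^{mn}` anticommute and `V = exp (-iθΓ^{ab}/2)` gives
`V† A_{mn} V = A_{mn} exp (-iθΓ^{ab})`; otherwise they commute and nothing happens. The `A_i` are
multiples of unitaries, so all outcomes are equally likely and the success probability is the
proportion `2(2ℓ-1) / ℓ(2ℓ+1)` of pairs of the first kind. Moving an exponential past a byproduct
at most reverses its angle, so one further site suffices to multiply an induced gate by any
`exp (-iθΓ^{ab})`.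

For projections, let `T` be the action on the on-site space of the permutation that exchanges `a`
and `b`. It is a Hermitian involution which multiplies the enacted `A_i` by `± i Γ^{ab}` on the
pairs of the first kind and by `± 1` on the others. The basis rotated by `(1 + iT)/√2` therefore
enacts multiples of `A_i (1 ± Γ^{ab})` on the former and, once the phases of its other vectors are
corrected, `A_i` on the latter.
-/

noncomputable section

namespace AKLT

open Matrix

/-! ### Irreducible matrix algebras -/

section FullMatrixAlgebra

variable {κ : Type} [Fintype κ] {S T : Set (Matrix κ κ ℂ)}

lemma ActsIrreducibly.mono (hS : ActsIrreducibly S) (hST : S ⊆ T) : ActsIrreducibly T :=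
  ⟨hS.1, fun E hE => hS.2 E fun M hM => hE M (hST hM)⟩

lemma actsIrreducibly_univ [Nonempty κ] : ActsIrreducibly (Set.univ : Set (Matrix κ κ ℂ)) := by
  classical
  refine ⟨‹_›, fun E hE => or_iff_not_imp_left.2 fun hE0 => eq_top_iff.2 fun w _ => ?_⟩
  obtain ⟨v, hvE, hv⟩ := E.ne_bot_iff.1 hE0
  obtain ⟨x, hx : v x ≠ 0⟩ := Function.ne_iff.1 hv
  have hw : vecMulVec w (Pi.single x (v x)⁻¹) *ᵥ v = w := by
    rw [vecMulVec_mulVec, single_dotProduct, inv_mul_cancel₀ hx, MulOpposite.op_one, one_smul]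
  exact hw ▸ hE _ (Set.mem_univ _) v hvE

variable [DecidableEq κ]

lemma actsIrreducibly_adjoin_iff :
    ActsIrreducibly (Algebra.adjoin ℂ S : Set (Matrix κ κ ℂ)) ↔ ActsIrreducibly S := by
  refine ⟨fun h => ⟨h.1, fun E hE => h.2 E fun M hM => ?_⟩, fun h => h.mono Algebra.subset_adjoin⟩
  induction hM using Algebra.adjoin_induction with
  | mem M hM => exact hE M hM
  | algebraMap r =>
    intro v hv
    rw [Algebra.algebraMap_eq_smul_one, smul_mulVec, one_mulVec]
    exact E.smul_mem r hv
  | add M N _ _ hM hN => exact fun v hv => add_mulVec M N v ▸ E.add_mem (hM v hv) (hN v hv)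
  | mul M N _ _ hM hN => exact fun v hv => mulVec_mulVec v M N ▸ hM _ (hN v hv)

lemma actsIrreducibly_of_adjoin_eq_top [Nonempty κ] (hS : Algebra.adjoin ℂ S = ⊤) :
    ActsIrreducibly S :=
  actsIrreducibly_adjoin_iff.1 <| by rw [hS, Algebra.coe_top]; exact actsIrreducibly_univ

lemma exists_eq_smul_one_of_commute_of_adjoin_eq_top {V : Matrix κ κ ℂ}
    (hS : Algebra.adjoin ℂ S = ⊤) (hV : ∀ M ∈ S, Commute M V) :
    ∃ c : ℂ, V = c • (1 : Matrix κ κ ℂ) := by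
  have hcomm : ∀ M, Commute V M := fun M =>
    Algebra.commute_of_mem_adjoin_of_forall_mem_commute (hS ▸ Algebra.mem_top)
      fun N hN => (hV N hN).symm
  have hV' : V ∈ Set.center (Matrix κ κ ℂ) := Semigroup.mem_center_iff.2 fun M => (hcomm M).symm
  rw [Matrix.center_eq_range ℂ] at hV'
  obtain ⟨c, rfl⟩ := hV'
  exact ⟨c, (smul_one_eq_diagonal c).symm⟩

end FullMatrixAlgebra

/-! ### Operators on several qubits -/

section QubitTensor

variable {ℓ : ℕ} (P Q : Matrix (Fin 2) (Fin 2) ℂ) (M N : Matrix (Qubits ℓ) (Qubits ℓ) ℂ)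

open scoped Kronecker TensorProduct

lemma qubitTensor_eq_submatrix_kronecker :
    qubitTensor P M = (P ⊗ₖ M).submatrix (Fin.consEquiv fun _ => Fin 2).symm
      (Fin.consEquiv fun _ => Fin 2).symm := rfl

variable (ℓ) in
/-- `P ⊗ M ↦ qubitTensor P M`, as an isomorphism from the algebraic tensor product of the two
matrix algebras. -/
def qubitTensorEquiv : Matrix (Fin 2) (Fin 2) ℂ ⊗[ℂ] Matrix (Qubits ℓ) (Qubits ℓ) ℂ ≃ₐ[ℂ]
    Matrix (Qubits (ℓ + 1)) (Qubits (ℓ + 1)) ℂ :=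
  (kroneckerAlgEquiv _ _ ℂ).trans (reindexAlgEquiv ℂ ℂ (Fin.consEquiv fun _ => Fin 2))

lemma qubitTensorEquiv_tmul : qubitTensorEquiv ℓ (P ⊗ₜ M) = qubitTensor P M := by
  simp [qubitTensorEquiv, qubitTensor_eq_submatrix_kronecker]

lemma qubitTensor_mul : qubitTensor P M * qubitTensor Q N = qubitTensor (P * Q) (M * N) := by
  simp only [← qubitTensorEquiv_tmul, ← map_mul, Algebra.TensorProduct.tmul_mul_tmul]

lemma qubitTensor_one : qubitTensor 1 (1 : Matrix (Qubits ℓ) (Qubits ℓ) ℂ) = 1 := by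
  rw [← qubitTensorEquiv_tmul, ← Algebra.TensorProduct.one_def, map_one]

lemma qubitTensor_smul_left (c : ℂ) : qubitTensor (c • P) M = c • qubitTensor P M := by
  simp only [← qubitTensorEquiv_tmul, ← TensorProduct.smul_tmul', map_smul]

lemma qubitTensor_smul_right (c : ℂ) : qubitTensor P (c • M) = c • qubitTensor P M := by
  simp only [← qubitTensorEquiv_tmul, TensorProduct.tmul_smul, map_smul]

lemma qubitTensor_neg_left : qubitTensor (-P) M = -qubitTensor P M := by
  simp only [← qubitTensorEquiv_tmul, TensorProduct.neg_tmul, map_neg]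

lemma qubitTensor_neg_right : qubitTensor P (-M) = -qubitTensor P M := by
  simp only [← qubitTensorEquiv_tmul, TensorProduct.tmul_neg, map_neg]

lemma qubitTensor_conjTranspose : (qubitTensor P M)ᴴ = qubitTensor Pᴴ Mᴴ := by
  simp only [qubitTensor_eq_submatrix_kronecker, conjTranspose_submatrix, conjTranspose_kronecker]

lemma qubitTensor_transpose : (qubitTensor P M)ᵀ = qubitTensor Pᵀ Mᵀ := rfl

lemma eq_top_of_forall_qubitTensor_mem
    {A : Subalgebra ℂ (Matrix (Qubits (ℓ + 1)) (Qubits (ℓ + 1)) ℂ)}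
    (hleft : ∀ P, qubitTensor P 1 ∈ A) (hright : ∀ M, qubitTensor 1 M ∈ A) : A = ⊤ := by
  refine eq_top_iff.2 fun T _ => ?_
  obtain ⟨t, rfl⟩ := (qubitTensorEquiv ℓ).surjective T
  induction t with
  | zero => exact map_zero (qubitTensorEquiv ℓ) ▸ A.zero_mem
  | add s t hs ht => exact map_add (qubitTensorEquiv ℓ) s t ▸ A.add_mem (hs trivial) (ht trivial)
  | tmul P M =>
    have hPM : qubitTensorEquiv ℓ (P ⊗ₜ M) = qubitTensor P 1 * qubitTensor 1 M := by
      rw [qubitTensorEquiv_tmul, qubitTensor_mul, mul_one, one_mul]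
    exact hPM ▸ A.mul_mem (hleft P) (hright M)

end QubitTensor

section Pauli

lemma pauli_mul_self (i : Fin 4) : pauli i * pauli i = 1 := by
  fin_cases i <;> simp [pauli, Matrix.one_fin_two]

lemma pauli_conjTranspose (i : Fin 4) : (pauli i)ᴴ = pauli i := by
  fin_cases i <;> ext x y <;> fin_cases x <;> fin_cases y <;> simp [pauli]

lemma pauli_anticomm {i j : Fin 4} (hi : i ≠ 0) (hj : j ≠ 0) (hij : i ≠ j) :
    pauli i * pauli j = -(pauli j * pauli i) := by
  fin_cases i <;> fin_cases j <;> simp_all [pauli]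

lemma pauli_one_mul_two : pauli 1 * pauli 2 = Complex.I • pauli 3 := by simp [pauli]

lemma pauli_two_mul_three : pauli 2 * pauli 3 = Complex.I • pauli 1 := by simp [pauli]

lemma pauli_three_mul_one : pauli 3 * pauli 1 = Complex.I • pauli 2 := by simp [pauli]

lemma exists_pauli_mul_pauli_eq_smul (i j : Fin 4) :
    ∃ (u : ℂ) (k : Fin 4), u ^ 4 = 1 ∧ pauli i * pauli j = u • pauli k := by
  have hI : Complex.I ^ 4 = 1 := Complex.I_pow_four
  have hI' : (-Complex.I) ^ 4 = 1 := (Even.neg_pow (by decide) _).trans hI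
  have h21 : pauli 2 * pauli 1 = -Complex.I • pauli 3 := by simp [pauli]
  have h32 : pauli 3 * pauli 2 = -Complex.I • pauli 1 := by simp [pauli]
  have h13 : pauli 1 * pauli 3 = -Complex.I • pauli 2 := by simp [pauli]
  by_cases hi : i = 0
  · exact ⟨1, j, one_pow 4, by rw [hi, one_smul]; exact one_mul _⟩
  by_cases hj : j = 0
  · exact ⟨1, i, one_pow 4, by rw [hj, one_smul]; exact mul_one _⟩
  by_cases hij : i = j
  · exact ⟨1, 0, one_pow 4, by rw [hij, pauli_mul_self, one_smul]; rfl⟩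
  fin_cases i <;> fin_cases j <;> first | contradiction | skip
  exacts [⟨_, 3, hI, pauli_one_mul_two⟩, ⟨_, 2, hI', h13⟩, ⟨_, 3, hI', h21⟩,
    ⟨_, 1, hI, pauli_two_mul_three⟩, ⟨_, 2, hI, pauli_three_mul_one⟩, ⟨_, 1, hI', h32⟩]

lemma span_range_pauli : Submodule.span ℂ (Set.range pauli) = ⊤ := by
  refine eq_top_iff.2 fun P _ => ?_
  have hP : P = ((P 0 0 + P 1 1) / 2) • pauli 0 + ((P 0 1 + P 1 0) / 2) • pauli 1
      + (Complex.I * (P 0 1 - P 1 0) / 2) • pauli 2 + ((P 0 0 - P 1 1) / 2) • pauli 3 := by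
    ext x y
    fin_cases x <;> fin_cases y <;> simp [pauli] <;> ring_nf <;> simp only [Complex.I_sq] <;> ring
  have hmem : ∀ (c : ℂ) i, c • pauli i ∈ Submodule.span ℂ (Set.range pauli) := fun c i =>
    Submodule.smul_mem _ c (Submodule.subset_span ⟨i, rfl⟩)
  exact hP ▸ add_mem (add_mem (add_mem (hmem _ 0) (hmem _ 1)) (hmem _ 2)) (hmem _ 3)

end Pauli

section IsPauliOp

variable {ℓ : ℕ} {M N : Matrix (Qubits ℓ) (Qubits ℓ) ℂ}

lemma isPauliOp_pauliString_mul_pauliString (s t : Fin ℓ → Fin 4) :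
    IsPauliOp (pauliString s * pauliString t) := by
  choose u k hu h using fun i => exists_pauli_mul_pauli_eq_smul (s i) (t i)
  refine ⟨∏ i, u i, k, by simp only [← Finset.prod_pow, hu, Finset.prod_const_one], ?_⟩
  ext x y
  have hentry : ∀ i, ∑ z, pauli (s i) (x i) z * pauli (t i) z (y i)
      = u i * pauli (k i) (x i) (y i) :=
    fun i => congrFun (congrFun (h i) (x i)) (y i)
  simp only [pauliString, mul_apply, of_apply, Matrix.smul_apply, smul_eq_mul,
    ← Finset.prod_mul_distrib, ← hentry, Fintype.prod_sum]

lemma IsPauliOp.smul (hM : IsPauliOp M) {c : ℂ} (hc : c ^ 4 = 1) : IsPauliOp (c • M) := by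
  obtain ⟨u, s, hu, rfl⟩ := hM
  exact ⟨c * u, s, by rw [mul_pow, hu, hc, one_mul], smul_smul _ _ _⟩

lemma IsPauliOp.mul (hM : IsPauliOp M) (hN : IsPauliOp N) : IsPauliOp (M * N) := by
  obtain ⟨u, s, hu, rfl⟩ := hM
  obtain ⟨v, t, hv, rfl⟩ := hN
  rw [smul_mul_smul_comm]
  exact (isPauliOp_pauliString_mul_pauliString s t).smul (by rw [mul_pow, hu, hv, one_mul])

variable (ℓ) in
lemma isPauliOp_one : IsPauliOp (1 : Matrix (Qubits ℓ) (Qubits ℓ) ℂ) := by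
  refine ⟨1, fun _ => 0, one_pow 4, ?_⟩
  ext x y
  simp only [pauliString, pauli, one_smul, of_apply, one_apply, Matrix.cons_val_zero,
    Finset.prod_ite_zero, Finset.prod_const_one, funext_iff, Finset.mem_univ, true_imp_iff]

lemma IsPauliOp.list_prod {L : List (Matrix (Qubits ℓ) (Qubits ℓ) ℂ)}
    (hL : ∀ M ∈ L, IsPauliOp M) : IsPauliOp L.prod :=
  List.prod_induction _ (fun _ _ => IsPauliOp.mul) (isPauliOp_one ℓ) hL

lemma IsPauliOp.qubitTensor (hM : IsPauliOp M) (i : Fin 4) :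
    IsPauliOp (qubitTensor (pauli i) M) := by
  obtain ⟨u, s, hu, rfl⟩ := hM
  refine ⟨u, Fin.cons i s, hu, ?_⟩
  rw [qubitTensor_smul_right]
  congr 1
  ext x y
  simp [AKLT.qubitTensor, pauliString, Fin.prod_univ_succ, Fin.tail]

end IsPauliOp

/-! ### Plane rotations -/

section PlaneRotations

variable {ι : Type*} [DecidableEq ι]

/-- The rotation by the angle `θ` in the plane of the coordinates `a ≠ b`, sending `e_a` to
`cos θ e_a + sin θ e_b`. -/
def planeRot (a b : ι) (θ : ℝ) : Matrix ι ι ℝ :=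
  of fun i =>
    if i = a then Pi.single a (Real.cos θ) - Pi.single b (Real.sin θ)
    else if i = b then Pi.single a (Real.sin θ) + Pi.single b (Real.cos θ)
    else Pi.single i 1

variable {a b : ι}

lemma planeRot_zero : planeRot a b 0 = 1 := by
  ext i j
  simp only [planeRot, of_apply, Real.cos_zero, Real.sin_zero, Pi.single_zero, sub_zero, zero_add,
    one_apply, ← Pi.single_apply, eq_comm (a := i) (b := j)]
  split_ifs <;> simp_all

lemma planeRot_transpose (hab : a ≠ b) (θ : ℝ) : (planeRot a b θ)ᵀ = planeRot a b (-θ) := by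
  ext i j
  by_cases hia : i = a <;> by_cases hib : i = b <;> by_cases hja : j = a <;>
    by_cases hjb : j = b <;>
    simp_all [planeRot, Pi.single_apply, eq_comm]

variable [Fintype ι]

lemma planeRot_mulVec_apply (θ : ℝ) (v : ι → ℝ) (i : ι) :
    (planeRot a b θ *ᵥ v) i = if i = a then Real.cos θ * v a - Real.sin θ * v b
      else if i = b then Real.sin θ * v a + Real.cos θ * v b else v i := by
  change (if i = a then Pi.single a (Real.cos θ) - Pi.single b (Real.sin θ)
    else if i = b then Pi.single a (Real.sin θ) + Pi.single b (Real.cos θ)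
    else (Pi.single i 1 : ι → ℝ)) ⬝ᵥ v = _
  split_ifs
  · rw [sub_dotProduct, single_dotProduct, single_dotProduct]
  · rw [add_dotProduct, single_dotProduct, single_dotProduct]
  · rw [single_dotProduct, one_mul]

lemma planeRot_mulVec_single {j : ι} (hja : j ≠ a) (hjb : j ≠ b) (θ : ℝ) :
    planeRot a b θ *ᵥ (Pi.single j 1 : ι → ℝ) = Pi.single j 1 := by
  ext i
  rw [planeRot_mulVec_apply, Pi.single_eq_of_ne hja.symm, Pi.single_eq_of_ne hjb.symm]
  split_ifs with hia hib
  · rw [hia, Pi.single_eq_of_ne hja.symm]; ring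
  · rw [hib, Pi.single_eq_of_ne hjb.symm]; ring
  · rfl

lemma planeRot_mul_planeRot (hab : a ≠ b) (θ η : ℝ) :
    planeRot a b θ * planeRot a b η = planeRot a b (θ + η) := by
  refine ext_of_mulVec_single fun j => funext fun i => ?_
  rw [← mulVec_mulVec]
  simp only [planeRot_mulVec_apply, if_neg hab.symm, if_true, Real.cos_add, Real.sin_add]
  split_ifs <;> ring

lemma planeRot_mem_specialOrthogonalGroup (hab : a ≠ b) (θ : ℝ) :
    planeRot a b θ ∈ specialOrthogonalGroup ι ℝ := by
  have horth : ∀ η, planeRot a b η * (planeRot a b η)ᵀ = 1 := fun η => by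
    rw [planeRot_transpose hab, planeRot_mul_planeRot hab, add_neg_cancel, planeRot_zero]
  refine mem_specialOrthogonalGroup_iff.2 ⟨(mem_orthogonalGroup_iff _ _).2 (horth θ), ?_⟩
  have hdet := congrArg det (horth (θ / 2))
  rwa [det_mul, det_transpose, ← det_mul, planeRot_mul_planeRot hab, add_halves, det_one] at hdet

lemma exists_angle_rotating_to_nonneg (x y : ℝ) :
    ∃ θ : ℝ, Real.cos θ * x - Real.sin θ * y = 0 ∧ 0 ≤ Real.sin θ * x + Real.cos θ * y := by
  set z : ℂ := ⟨y, x⟩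
  have hx : ‖z‖ * Real.sin z.arg = x := Complex.norm_mul_sin_arg z
  have hy : ‖z‖ * Real.cos z.arg = y := Complex.norm_mul_cos_arg z
  refine ⟨z.arg, by rw [← hx, ← hy]; ring, ?_⟩
  have hr : Real.sin z.arg * x + Real.cos z.arg * y = ‖z‖ := by
    linear_combination ‖z‖ * Real.sin_sq_add_cos_sq z.arg - Real.sin z.arg * hx
      - Real.cos z.arg * hy
  exact hr ▸ norm_nonneg z

/-- The subgroup of the special orthogonal group generated by the rotations in the coordinate
planes spanned by two coordinates in `t`. -/
def planeRotGroup (t : Finset ι) : Subgroup (specialOrthogonalGroup ι ℝ) :=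
  Subgroup.closure {r | ∃ a ∈ t, ∃ b ∈ t, a ≠ b ∧ ∃ θ, r.1 = planeRot a b θ}

lemma planeRotGroup_mono {s t : Finset ι} (hst : s ⊆ t) : planeRotGroup s ≤ planeRotGroup t :=
  Subgroup.closure_mono fun _ ⟨a, ha, b, hb, h⟩ => ⟨a, hst ha, b, hst hb, h⟩

lemma mulVec_single_of_mem_planeRotGroup {t : Finset ι} {r : specialOrthogonalGroup ι ℝ}
    (hr : r ∈ planeRotGroup t) {j : ι} (hj : j ∉ t) :
    r.1 *ᵥ (Pi.single j 1 : ι → ℝ) = Pi.single j 1 := by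
  induction hr using Subgroup.closure_induction with
  | mem r hr =>
    obtain ⟨a, ha, b, hb, -, θ, hr⟩ := hr
    rw [hr, planeRot_mulVec_single (ne_of_mem_of_not_mem ha hj).symm
      (ne_of_mem_of_not_mem hb hj).symm]
  | one => exact one_mulVec _
  | mul r s _ _ hr hs => rw [Submonoid.coe_mul, ← mulVec_mulVec, hs, hr]
  | inv r _ hr =>
    nth_rewrite 1 [← hr]
    rw [mulVec_mulVec, ← Submonoid.coe_mul, inv_mul_cancel, Submonoid.coe_one, one_mulVec]

lemma mulVec_dotProduct_mulVec_of_mem_orthogonalGroup {g : Matrix ι ι ℝ}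
    (hg : g ∈ orthogonalGroup ι ℝ) (v w : ι → ℝ) : (g *ᵥ v) ⬝ᵥ (g *ᵥ w) = v ⬝ᵥ w := by
  rw [dotProduct_mulVec, ← mulVec_transpose, mulVec_mulVec,
    (mem_orthogonalGroup_iff' _ _).1 hg, one_mulVec]

lemma exists_mem_planeRotGroup_mulVec_eq_zero {K : ι} (v : ι → ℝ) (u : Finset ι) (hK : K ∉ u) :
    ∃ h ∈ planeRotGroup (insert K u), (∀ i ∈ u, (h.1 *ᵥ v) i = 0) ∧
      (∀ j ∉ insert K u, (h.1 *ᵥ v) j = v j) ∧ (u.Nonempty → 0 ≤ (h.1 *ᵥ v) K) := by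
  induction u using Finset.induction_on with
  | empty =>
    exact ⟨1, one_mem _, by simp, fun j _ => by simp, fun h => absurd h Finset.not_nonempty_empty⟩
  | insert M u _ ih =>
    obtain ⟨hKM, hKu⟩ : K ≠ M ∧ K ∉ u := by simpa [not_or] using hK
    obtain ⟨h, hh, hzero, hfix, -⟩ := ih hKu
    obtain ⟨θ, hθM, hθK⟩ := exists_angle_rotating_to_nonneg ((h.1 *ᵥ v) M) ((h.1 *ᵥ v) K)
    let r : specialOrthogonalGroup ι ℝ :=
      ⟨planeRot M K θ, planeRot_mem_specialOrthogonalGroup hKM.symm θ⟩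
    have hr : ∀ i, ((r * h).1 *ᵥ v) i = _ := fun i =>
      (congrFun (mulVec_mulVec v r.1 h.1).symm i).trans (planeRot_mulVec_apply θ (h.1 *ᵥ v) i)
    refine ⟨r * h, mul_mem (Subgroup.subset_closure ⟨M, by simp, K, by simp, hKM.symm, θ, rfl⟩)
      (planeRotGroup_mono (by grind) hh), fun i hi => ?_, fun j hj => ?_, fun _ => ?_⟩
    · rw [hr]
      split_ifs with hiM hiK
      · exact hθM
      · exact absurd hi (hiK ▸ hK)
      · exact hzero i (Finset.mem_of_mem_insert_of_ne hi hiM)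
    · rw [hr, if_neg (by grind), if_neg (by grind), hfix j (by grind)]
    · rw [hr, if_neg hKM, if_pos rfl]
      exact hθK

lemma exists_mem_planeRotGroup_mulVec_eq_single {K : ι} {u : Finset ι} (hK : K ∉ u)
    (hu : u.Nonempty) {v : ι → ℝ} (hv : v ⬝ᵥ v = 1) (hsupp : ∀ j ∉ insert K u, v j = 0) :
    ∃ h ∈ planeRotGroup (insert K u), h.1 *ᵥ v = Pi.single K 1 := by
  obtain ⟨h, hh, hzero, hfix, hpos⟩ := exists_mem_planeRotGroup_mulVec_eq_zero v u hK
  have hsingle : h.1 *ᵥ v = Pi.single K ((h.1 *ᵥ v) K) := by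
    ext i
    by_cases hiK : i = K
    · rw [hiK, Pi.single_eq_same]
    · rw [Pi.single_eq_of_ne hiK]
      by_cases hi : i ∈ u
      · exact hzero i hi
      · have hi' : i ∉ insert K u := by grind
        rw [hfix i hi', hsupp i hi']
  have hnorm := mulVec_dotProduct_mulVec_of_mem_orthogonalGroup
    (mem_specialOrthogonalGroup_iff.1 h.2).1 v v
  rw [hv, hsingle, single_dotProduct, Pi.single_eq_same, ← sq] at hnorm
  have hK1 : (h.1 *ᵥ v) K = 1 := (pow_eq_one_iff_of_nonneg (hpos hu) two_ne_zero).1 hnorm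
  exact ⟨h, hh, hsingle.trans (by rw [hK1])⟩

lemma eq_one_of_mulVec_single_eq_self {g : Matrix ι ι ℝ} (hg : g ∈ specialOrthogonalGroup ι ℝ)
    {K : ι} (hfix : ∀ j ≠ K, g *ᵥ (Pi.single j 1 : ι → ℝ) = Pi.single j 1) : g = 1 := by
  obtain ⟨horth, hdet⟩ := mem_specialOrthogonalGroup_iff.1 hg
  have hcol : g = updateCol 1 K (g *ᵥ Pi.single K 1) := by
    ext i j
    by_cases hj : j = K
    · rw [hj, updateCol_self, mulVec_single_one, col_apply]
    · rw [updateCol_ne hj, ← col_apply g, ← mulVec_single_one, hfix j hj, one_apply,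
        Pi.single_apply]
  have hKK : g K K = 1 := by
    rw [hcol, ← cramer_apply, cramer_one] at hdet
    simpa using hdet
  refine ext_of_mulVec_single fun j => ?_
  rw [one_mulVec]
  by_cases hj : j = K
  · subst hj
    ext i
    by_cases hi : i = j
    · rw [hi]; simpa using hKK
    · have := mulVec_dotProduct_mulVec_of_mem_orthogonalGroup horth (Pi.single i 1) (Pi.single j 1)
      rw [hfix i hi, single_dotProduct, single_dotProduct, one_mul, one_mul] at this
      exact this
  · exact hfix j hj

lemma mem_planeRotGroup_of_mulVec_single_eq_self (t : Finset ι) (g : specialOrthogonalGroup ι ℝ)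
    (hfix : ∀ j ∉ t, g.1 *ᵥ (Pi.single j 1 : ι → ℝ) = Pi.single j 1) : g ∈ planeRotGroup t := by
  induction t using Finset.induction_on generalizing g with
  | empty =>
    have hg : g = 1 := Subtype.ext <| ext_of_mulVec_single fun j => by
      rw [hfix j (Finset.notMem_empty j), Submonoid.coe_one, one_mulVec]
    exact hg ▸ one_mem _
  | insert K u hK ih =>
    obtain rfl | hu := u.eq_empty_or_nonempty
    · have hg : g = 1 := Subtype.ext <| eq_one_of_mulVec_single_eq_self g.2 fun j hj =>
        hfix j (by simpa using hj)
      exact hg ▸ one_mem _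
    have horth := mulVec_dotProduct_mulVec_of_mem_orthogonalGroup
      (mem_specialOrthogonalGroup_iff.1 g.2).1
    obtain ⟨h, hh, hhg⟩ := exists_mem_planeRotGroup_mulVec_eq_single hK hu
      (v := g.1 *ᵥ Pi.single K 1) (by rw [horth]; simp) fun j hj => by
        have := horth (Pi.single j 1) (Pi.single K 1)
        rw [hfix j hj, single_dotProduct, single_dotProduct, one_mul, one_mul,
          Pi.single_eq_of_ne (by grind)] at this
        exact this
    refine (Subgroup.mul_mem_cancel_left _ hh).1 (planeRotGroup_mono (Finset.subset_insert K u)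
      (ih (h * g) fun j hj => ?_))
    rw [Submonoid.coe_mul, ← mulVec_mulVec]
    by_cases hjK : j = K
    · rw [hjK, hhg]
    · have hj' : j ∉ insert K u := by grind
      rw [hfix j hj', mulVec_single_of_mem_planeRotGroup hh hj']

theorem planeRotGroup_univ : planeRotGroup (Finset.univ : Finset ι) = ⊤ :=
  eq_top_iff.2 fun g _ => mem_planeRotGroup_of_mulVec_single_eq_self _ g fun j hj =>
    absurd (Finset.mem_univ j) hj

end PlaneRotations

/-! ### Compactness of the unitary groups -/

section Compactness

variable {n 𝕜 : Type*} [Fintype n] [DecidableEq n] [RCLike 𝕜]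

lemma isCompact_unitaryGroup : IsCompact (unitaryGroup n 𝕜 : Set (Matrix n n 𝕜)) := by
  have hbox : IsCompact (Set.univ.pi fun _ : n => Set.univ.pi fun _ : n =>
      Metric.closedBall (0 : 𝕜) 1) :=
    isCompact_univ_pi fun _ => isCompact_univ_pi fun _ => isCompact_closedBall 0 1
  refine hbox.of_isClosed_subset ?_ fun U hU i _ j _ =>
    mem_closedBall_zero_iff.2 (entry_norm_bound_of_unitary hU i j)
  have hset : (unitaryGroup n 𝕜 : Set (Matrix n n 𝕜)) = {A | A * star A = 1} :=
    Set.ext fun _ => mem_unitaryGroup_iff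
  rw [hset]
  exact isClosed_eq (by fun_prop) continuous_const

instance compactSpace_unitaryGroup : CompactSpace (unitaryGroup n 𝕜) :=
  isCompact_iff_compactSpace.1 isCompact_unitaryGroup

instance compactSpace_specialUnitaryGroup : CompactSpace (specialUnitaryGroup n 𝕜) := by
  have hset : (specialUnitaryGroup n 𝕜 : Set (Matrix n n 𝕜))
      = (unitaryGroup n 𝕜 : Set (Matrix n n 𝕜)) ∩ {A | A.det = 1} :=
    Set.ext fun _ => mem_specialUnitaryGroup_iff
  refine isCompact_iff_compactSpace.1 ?_
  rw [hset]
  exact isCompact_unitaryGroup.inter_right (isClosed_eq continuous_id.matrix_det continuous_const)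

lemma continuous_of_isClosed_graph {X Y : Type*} [TopologicalSpace X] [TopologicalSpace Y]
    [CompactSpace Y] {f : X → Y} (hf : IsClosed {x : X × Y | f x.1 = x.2}) : Continuous f := by
  refine continuous_iff_isClosed.2 fun s hs => ?_
  have himage : f ⁻¹' s = Prod.fst '' ({x : X × Y | f x.1 = x.2} ∩ Prod.snd ⁻¹' s) := by
    ext x; simp
  rw [himage]
  exact isClosedMap_fst_of_compactSpace _ (hf.inter (hs.preimage continuous_snd))

end Compactness

/-! ### Rotors and Clifford families -/

section Rotor

variable {A : Type*}

/-- For `J² = -1`, the exponential `exp (-θ J)`, see `exp_neg_smul`. -/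
def rotor [Ring A] [Algebra ℝ A] (J : A) (θ : ℝ) : A := Real.cos θ • 1 - Real.sin θ • J

lemma exp_neg_smul [NormedRing A] [NormedAlgebra ℝ A] {J : A} (hJ : J * J = -1) (θ : ℝ) :
    NormedSpace.exp (-(θ • J)) = rotor J θ := by
  let _ : NormedAlgebra ℚ A := NormedAlgebra.restrictScalars ℚ ℝ A
  have hcont : Continuous (Complex.liftAux J hJ) :=
    (Complex.liftAux J hJ).toLinearMap.continuous_of_finiteDimensional
  have hexp := NormedSpace.map_exp (Complex.liftAux J hJ) hcont ((-θ : ℝ) * Complex.I)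
  rw [← Complex.exp_eq_exp_ℂ, Complex.liftAux_apply, Complex.liftAux_apply,
    Complex.exp_ofReal_mul_I_re, Complex.exp_ofReal_mul_I_im, Real.cos_neg, Real.sin_neg,
    Complex.re_ofReal_mul, Complex.im_ofReal_mul, Complex.I_re, Complex.I_im] at hexp
  simp only [mul_zero, mul_one, map_zero, zero_add, neg_smul] at hexp
  rw [← hexp, rotor, Algebra.algebraMap_eq_smul_one, sub_eq_add_neg]

variable [Ring A] [Algebra ℝ A] {J x : A}

lemma rotor_zero : rotor J 0 = 1 := by simp [rotor]

lemma rotor_pi : rotor J Real.pi = -1 := by simp [rotor]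

lemma rotor_mul_rotor (hJ : J * J = -1) (θ η : ℝ) :
    rotor J θ * rotor J η = rotor J (θ + η) := by
  simp only [rotor, Real.cos_add, Real.sin_add, sub_mul, mul_sub, smul_mul_assoc, mul_smul_comm,
    one_mul, mul_one, hJ]
  module

lemma rotor_mul_of_commute (hx : Commute J x) (θ : ℝ) : rotor J θ * x = x * rotor J θ := by
  simp only [rotor, sub_mul, mul_sub, smul_mul_assoc, mul_smul_comm, one_mul, mul_one, hx.eq]

lemma rotor_neg_mul_of_anticommute (hx : J * x = -(x * J)) (θ : ℝ) :
    rotor J (-θ) * x = x * rotor J θ := by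
  simp only [rotor, Real.cos_neg, Real.sin_neg, sub_mul, mul_sub, neg_mul, neg_smul, smul_neg,
    smul_mul_assoc, mul_smul_comm, one_mul, mul_one, hx, neg_neg]

lemma rotor_neg_mul_mul_rotor_of_commute (hJ : J * J = -1) (hx : Commute J x) (θ : ℝ) :
    rotor J (-θ) * x * rotor J θ = x := by
  rw [rotor_mul_of_commute hx, mul_assoc, rotor_mul_rotor hJ, neg_add_cancel, rotor_zero, mul_one]

lemma rotor_neg_mul_mul_rotor_of_anticommute (hJ : J * J = -1) (hx : J * x = -(x * J)) (θ : ℝ) :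
    rotor J (-(θ / 2)) * x * rotor J (θ / 2) = x * rotor J θ := by
  rw [rotor_neg_mul_of_anticommute hx, mul_assoc, rotor_mul_rotor hJ, add_halves]

variable [StarRing A] [StarModule ℝ A]

lemma star_rotor (hJ : star J = -J) (θ : ℝ) : star (rotor J θ) = rotor J (-θ) := by
  simp [rotor, hJ]

lemma rotor_mem_unitary (hJ : J * J = -1) (hJ' : star J = -J) (θ : ℝ) :
    rotor J θ ∈ unitary A := by
  rw [Unitary.mem_iff, star_rotor hJ', rotor_mul_rotor hJ, rotor_mul_rotor hJ, neg_add_cancel,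
    add_neg_cancel, rotor_zero, and_self]

end Rotor

/-- A family of pairwise anticommuting self-adjoint square roots of `1`. -/
structure IsCliffordFamily {ι A : Type*} [Ring A] [StarRing A] (Γ : ι → A) : Prop where
  star_eq (a : ι) : star (Γ a) = Γ a
  mul_self (a : ι) : Γ a * Γ a = 1
  anticomm {a b : ι} (hab : a ≠ b) : Γ a * Γ b = -(Γ b * Γ a)

namespace IsCliffordFamily

variable {ι A : Type*} [Ring A] [StarRing A] {Γ : ι → A}

section Bivectors

variable {a b i : ι}

lemma bivector_mul_self (hΓ : IsCliffordFamily Γ) (hab : a ≠ b) :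
    Γ a * Γ b * (Γ a * Γ b) = -1 := by
  nth_rewrite 1 [hΓ.anticomm hab]
  rw [neg_mul, mul_assoc, ← mul_assoc (Γ a), hΓ.mul_self, one_mul, hΓ.mul_self]

lemma star_bivector (hΓ : IsCliffordFamily Γ) (hab : a ≠ b) :
    star (Γ a * Γ b) = -(Γ a * Γ b) := by
  rw [star_mul, hΓ.star_eq, hΓ.star_eq, hΓ.anticomm hab, neg_neg]

lemma bivector_mul_left (hΓ : IsCliffordFamily Γ) (hab : a ≠ b) :
    Γ a * Γ b * Γ a = -(Γ a * (Γ a * Γ b)) := by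
  rw [mul_assoc, hΓ.anticomm hab.symm, mul_neg]

lemma bivector_mul_right (hΓ : IsCliffordFamily Γ) (hab : a ≠ b) :
    Γ a * Γ b * Γ b = -(Γ b * (Γ a * Γ b)) := by
  rw [← mul_assoc, hΓ.anticomm hab.symm, neg_mul, neg_neg]

lemma commute_bivector (hΓ : IsCliffordFamily Γ) (hai : a ≠ i) (hbi : b ≠ i) :
    Commute (Γ a * Γ b) (Γ i) := by
  rw [commute_iff_eq, mul_assoc, hΓ.anticomm hbi, mul_neg, ← mul_assoc, hΓ.anticomm hai, neg_mul,
    neg_neg, mul_assoc]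

end Bivectors

variable [Algebra ℝ A]

lemma sum_smul_anticommutator [Fintype ι] (hΓ : IsCliffordFamily Γ) (c : ι → ℝ) (a : ι) :
    (∑ m, c m • Γ m) * Γ a + Γ a * ∑ m, c m • Γ m = (2 * c a) • 1 := by
  rw [Finset.sum_mul, Finset.mul_sum, ← Finset.sum_add_distrib, Fintype.sum_eq_single a]
  · rw [smul_mul_assoc, mul_smul_comm, hΓ.mul_self, ← two_smul ℝ, smul_smul]
  · intro m hm
    rw [smul_mul_assoc, mul_smul_comm, hΓ.anticomm hm, smul_neg, neg_add_cancel]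

lemma linearIndependent [Finite ι] [Nontrivial A] (hΓ : IsCliffordFamily Γ) :
    LinearIndependent ℝ Γ := by
  cases nonempty_fintype ι
  refine Fintype.linearIndependent_iff.2 fun c hc a => ?_
  have h := hΓ.sum_smul_anticommutator c a
  rw [hc, zero_mul, mul_zero, add_zero, eq_comm, smul_eq_zero_iff_left one_ne_zero] at h
  exact (mul_eq_zero_iff_left two_ne_zero).1 h

end IsCliffordFamily

/-! ### Rotations implemented by conjugation -/

section Intertwiners

variable {ι A : Type*} [Fintype ι] [Ring A] [Algebra ℝ A]

lemma mul_sum_smul_mul {Γ : ι → A} {V W : A} {g : Matrix ι ι ℝ}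
    (hg : ∀ a, W * Γ a * V = ∑ m, g a m • Γ m) (c : ι → ℝ) :
    W * (∑ m, c m • Γ m) * V = ∑ k, (c ᵥ* g) k • Γ k := by
  simp only [Finset.mul_sum, Finset.sum_mul, mul_smul_comm, smul_mul_assoc, hg, Finset.smul_sum,
    smul_smul, vecMul, dotProduct, Finset.sum_smul]
  exact Finset.sum_comm

variable [StarRing A] [DecidableEq ι] {Γ : ι → A}

/-- The pairs of a unitary `V` and a rotation `g` such that conjugation by `V` acts on the family
`Γ` by the matrix `g`. -/
def intertwiners (Γ : ι → A) : Subgroup (unitary A × specialOrthogonalGroup ι ℝ) where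
  carrier := {x | ∀ a, star x.1.1 * Γ a * x.1.1 = ∑ m, x.2.1 a m • Γ m}
  one_mem' a := by simp [one_apply]
  mul_mem' {x y} hx hy a := by
    calc star (x.1.1 * y.1.1) * Γ a * (x.1.1 * y.1.1)
        = star y.1.1 * (star x.1.1 * Γ a * x.1.1) * y.1.1 := by simp only [star_mul, mul_assoc]
      _ = ∑ k, (x.2.1 a ᵥ* y.2.1) k • Γ k := by rw [hx a, mul_sum_smul_mul hy]
  inv_mem' {x} hx a := by
    have hunit : x.1.1 * star x.1.1 = 1 := Unitary.coe_mul_star_self x.1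
    have hinv : x.2⁻¹.1 * x.2.1 = 1 := congrArg Subtype.val (inv_mul_cancel x.2)
    have hΓ : star x.1.1 * (∑ m, x.2⁻¹.1 a m • Γ m) * x.1.1 = Γ a := by
      rw [mul_sum_smul_mul hx, ← mul_apply_eq_vecMul, hinv]
      simp [one_apply]
    change star (star x.1.1) * Γ a * star x.1.1 = ∑ m, x.2⁻¹.1 a m • Γ m
    rw [star_star, ← hΓ, mul_assoc, mul_assoc, hunit, mul_one, ← mul_assoc, hunit, one_mul]

lemma eq_of_mem_intertwiners [Nontrivial A] (hΓ : IsCliffordFamily Γ) {V : unitary A}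
    {g h : specialOrthogonalGroup ι ℝ} (hg : (V, g) ∈ intertwiners Γ)
    (hh : (V, h) ∈ intertwiners Γ) : g = h := by
  refine Subtype.ext <| ext fun a m => sub_eq_zero.1 ?_
  refine Fintype.linearIndependent_iff.1 hΓ.linearIndependent (g.1 a - h.1 a) ?_ m
  simp only [Pi.sub_apply, sub_smul, Finset.sum_sub_distrib, ← hg a, ← hh a, sub_self]

lemma mem_intertwiners_one_iff {V : unitary A} :
    (V, 1) ∈ intertwiners Γ ↔ ∀ a, Commute V.1 (Γ a) := by
  refine forall_congr' fun a => ?_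
  have hsum : ∑ m, (1 : Matrix ι ι ℝ) a m • Γ m = Γ a := by simp [one_apply]
  change star V.1 * Γ a * V.1 = ∑ m, (1 : Matrix ι ι ℝ) a m • Γ m ↔ _
  rw [hsum, commute_iff_eq, mul_assoc, eq_comm (a := V.1 * Γ a)]
  refine ⟨fun h => ?_, fun h => ?_⟩
  · rw [← congrArg (V.1 * ·) h]
    simp [← mul_assoc]
  · rw [h, ← mul_assoc, Unitary.coe_star_mul_self, one_mul]

lemma isClosed_intertwiners [TopologicalSpace A] [IsTopologicalRing A] [ContinuousStar A]
    [ContinuousSMul ℝ A] [T2Space A] :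
    IsClosed (intertwiners Γ : Set (unitary A × specialOrthogonalGroup ι ℝ)) := by
  have hset : (intertwiners Γ : Set (unitary A × specialOrthogonalGroup ι ℝ))
      = ⋂ a, {x | star x.1.1 * Γ a * x.1.1 = ∑ m, x.2.1 a m • Γ m} := by
    ext x
    rw [Set.mem_iInter]
    rfl
  rw [hset]
  refine isClosed_iInter fun a => isClosed_eq (by fun_prop) ?_
  refine continuous_finsetSum _ fun m _ => Continuous.smul ?_ continuous_const
  exact (continuous_subtype_val.comp continuous_snd).matrix_elem a m

variable [StarModule ℝ A] {a b : ι}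

lemma mem_intertwiners_of_eq_rotor (hΓ : IsCliffordFamily Γ) (hab : a ≠ b) {θ : ℝ} {V : unitary A}
    {r : specialOrthogonalGroup ι ℝ} (hV : V.1 = rotor (Γ a * Γ b) (θ / 2))
    (hr : r.1 = planeRot a b θ) : (V, r) ∈ intertwiners Γ := by
  intro i
  have hJ := hΓ.bivector_mul_self hab
  rw [hV, hr, star_rotor (hΓ.star_bivector hab)]
  by_cases hia : i = a
  · rw [hia, rotor_neg_mul_mul_rotor_of_anticommute hJ (hΓ.bivector_mul_left hab)]
    simp [planeRot, rotor, mul_sub, ← mul_assoc, hΓ.mul_self, sub_smul, Pi.single_apply]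
  by_cases hib : i = b
  · rw [hib, rotor_neg_mul_mul_rotor_of_anticommute hJ (hΓ.bivector_mul_right hab)]
    simp [planeRot, rotor, mul_sub, ← mul_assoc, hΓ.anticomm hab.symm, hab.symm, hΓ.mul_self,
      mul_assoc (Γ a), add_smul, Pi.single_apply, Finset.sum_add_distrib, add_comm]
  · rw [rotor_neg_mul_mul_rotor_of_commute hJ (hΓ.commute_bivector (Ne.symm hia) (Ne.symm hib))]
    simp [planeRot, hia, hib, Pi.single_apply]

/-- The group generated by the exponentials of the products `Γ_a Γ_b`, `a ≠ b`. -/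
def rotorGroup (Γ : ι → A) : Subgroup (unitary A) :=
  Subgroup.closure {V | ∃ a b, a ≠ b ∧ ∃ θ : ℝ, V.1 = rotor (Γ a * Γ b) θ}

lemma exists_mem_intertwiners (hΓ : IsCliffordFamily Γ) {V : unitary A} (hV : V ∈ rotorGroup Γ) :
    ∃ g, (V, g) ∈ intertwiners Γ := by
  have hle : rotorGroup Γ ≤ (intertwiners Γ).map (MonoidHom.fst _ _) := by
    refine (Subgroup.closure_le _).2 fun V ⟨a, b, hab, θ, hV⟩ => ?_
    refine ⟨(V, ⟨_, planeRot_mem_specialOrthogonalGroup hab (2 * θ)⟩), ?_, rfl⟩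
    exact mem_intertwiners_of_eq_rotor hΓ hab
      (by rw [hV, mul_div_cancel_left₀ θ two_ne_zero]) rfl
  obtain ⟨⟨_, g⟩, hg, rfl⟩ := hle hV
  exact ⟨g, hg⟩

section Hom

variable [Nontrivial A] (hΓ : IsCliffordFamily Γ)

/-- The covering homomorphism from the group generated by the exponentials of the `Γ_a Γ_b` onto
the rotation group. -/
def rotorHom : rotorGroup Γ →* specialOrthogonalGroup ι ℝ :=
  MonoidHom.mk' (fun V => (exists_mem_intertwiners hΓ V.2).choose) fun V W =>
    eq_of_mem_intertwiners hΓ (exists_mem_intertwiners hΓ (V * W).2).choose_spec <|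
      (intertwiners Γ).mul_mem (exists_mem_intertwiners hΓ V.2).choose_spec
        (exists_mem_intertwiners hΓ W.2).choose_spec

lemma rotorHom_mem_intertwiners (V : rotorGroup Γ) : (V.1, rotorHom hΓ V) ∈ intertwiners Γ :=
  (exists_mem_intertwiners hΓ V.2).choose_spec

lemma rotorHom_eq_iff {V : rotorGroup Γ} {g : specialOrthogonalGroup ι ℝ} :
    rotorHom hΓ V = g ↔ (V.1, g) ∈ intertwiners Γ :=
  ⟨fun h => h ▸ rotorHom_mem_intertwiners hΓ V,
    eq_of_mem_intertwiners hΓ (rotorHom_mem_intertwiners hΓ V)⟩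

lemma rotorHom_surjective : Function.Surjective (rotorHom hΓ) := by
  rw [← MonoidHom.range_eq_top, ← top_le_iff, ← planeRotGroup_univ, planeRotGroup,
    Subgroup.closure_le]
  rintro r ⟨a, -, b, -, hab, θ, hr⟩
  let V : unitary A := ⟨rotor (Γ a * Γ b) (θ / 2),
    rotor_mem_unitary (hΓ.bivector_mul_self hab) (hΓ.star_bivector hab) _⟩
  exact ⟨⟨V, Subgroup.subset_closure ⟨a, b, hab, _, rfl⟩⟩,
    (rotorHom_eq_iff hΓ).2 (mem_intertwiners_of_eq_rotor hΓ hab rfl hr)⟩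

lemma continuous_rotorHom [TopologicalSpace A] [IsTopologicalRing A] [ContinuousStar A]
    [ContinuousSMul ℝ A] [T2Space A] : Continuous (rotorHom hΓ) := by
  refine continuous_of_isClosed_graph ?_
  simp only [rotorHom_eq_iff]
  exact isClosed_intertwiners.preimage
    ((continuous_subtype_val.comp continuous_fst).prodMk continuous_snd)

end Hom

end Intertwiners

/-! ### The Clifford matrices -/

section Gamma

lemma cliffordAux_mul_self (ℓ i : ℕ) : cliffordAux ℓ i * cliffordAux ℓ i = 1 := by
  induction ℓ generalizing i with
  | zero => exact one_mul 1
  | succ ℓ ih =>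
    simp only [cliffordAux]
    split_ifs <;> simp only [qubitTensor_mul, pauli_mul_self, ih, mul_one, qubitTensor_one]

lemma cliffordAux_conjTranspose (ℓ i : ℕ) : (cliffordAux ℓ i)ᴴ = cliffordAux ℓ i := by
  induction ℓ generalizing i with
  | zero => exact conjTranspose_one
  | succ ℓ ih =>
    simp only [cliffordAux]
    split_ifs <;> simp only [qubitTensor_conjTranspose, pauli_conjTranspose, ih, conjTranspose_one]

lemma cliffordAux_anticomm (ℓ : ℕ) {i j : ℕ} (hi : i < 2 * ℓ + 1) (hj : j < 2 * ℓ + 1)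
    (hij : i ≠ j) : cliffordAux ℓ i * cliffordAux ℓ j = -(cliffordAux ℓ j * cliffordAux ℓ i) := by
  induction ℓ generalizing i j with
  | zero => omega
  | succ ℓ ih =>
    have h12 := pauli_anticomm (i := 1) (j := 2) (by decide) (by decide) (by decide)
    have h13 := pauli_anticomm (i := 1) (j := 3) (by decide) (by decide) (by decide)
    have h23 := pauli_anticomm (i := 2) (j := 3) (by decide) (by decide) (by decide)
    simp only [cliffordAux]
    split_ifs with h1 h2 h2 h3 h4 h4 h5 h6 <;>
      first
      | omega
      | rw [qubitTensor_mul, qubitTensor_mul, ih h1 h2 hij, qubitTensor_neg_right]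
      | simp only [qubitTensor_mul, mul_one, one_mul, h12, h13, h23, qubitTensor_neg_left, neg_neg]

lemma isPauliOp_cliffordAux (ℓ i : ℕ) : IsPauliOp (cliffordAux ℓ i) := by
  induction ℓ generalizing i with
  | zero => exact isPauliOp_one 0
  | succ ℓ ih =>
    simp only [cliffordAux]
    split_ifs
    · exact (ih i).qubitTensor 1
    · exact (isPauliOp_one ℓ).qubitTensor 2
    · exact (isPauliOp_one ℓ).qubitTensor 3

variable {ℓ : ℕ}

lemma isCliffordFamily_gamma : IsCliffordFamily (gamma ℓ) where
  star_eq a := cliffordAux_conjTranspose ℓ a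
  mul_self a := cliffordAux_mul_self ℓ a
  anticomm {a b} hab := cliffordAux_anticomm ℓ a.2 b.2 (Fin.val_ne_of_ne hab)

lemma isPauliOp_gamma_mul_gamma (a b : Fin (2 * ℓ + 1)) : IsPauliOp (gamma ℓ a * gamma ℓ b) :=
  (isPauliOp_cliffordAux ℓ a).mul (isPauliOp_cliffordAux ℓ b)

lemma isPauliOp_pairOp (p : Pair ℓ) : IsPauliOp (pairOp p) :=
  (isPauliOp_gamma_mul_gamma _ _).smul ((Even.neg_pow (by decide) _).trans Complex.I_pow_four)

lemma isPauliOp_byproduct {n : ℕ} (i : Fin n → Pair ℓ) : IsPauliOp (byproduct i) :=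
  IsPauliOp.list_prod fun _ hM => by
    obtain ⟨k, rfl⟩ := List.mem_ofFn.1 hM
    exact isPauliOp_pairOp (i k)

lemma expGate_eq_rotor {a b : Fin (2 * ℓ + 1)} (hab : a ≠ b) (θ : ℝ) :
    expGate a b θ = rotor (gamma ℓ a * gamma ℓ b) θ := by
  -- The norm only serves to sum the exponential series; its topology is that of the entries.
  let _ : NormedRing (Matrix (Qubits ℓ) (Qubits ℓ) ℂ) := Matrix.linftyOpNormedRing
  let _ : NormedAlgebra ℝ (Matrix (Qubits ℓ) (Qubits ℓ) ℂ) := Matrix.linftyOpNormedAlgebra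
  rw [← exp_neg_smul (isCliffordFamily_gamma.bivector_mul_self hab), expGate, gammaPair,
    smul_smul, ← Complex.coe_smul θ, ← neg_smul]
  congr 2
  linear_combination (θ : ℂ) * Complex.I_mul_I

lemma closure_expGate_eq_rotorGroup :
    Subgroup.closure {V : unitaryGroup (Qubits ℓ) ℂ | ∃ a b, a ≠ b ∧ ∃ θ : ℝ, V.1 = expGate a b θ}
      = rotorGroup (gamma ℓ) := by
  refine congrArg Subgroup.closure <| Set.ext fun V => exists₂_congr fun a b =>
    and_congr_right fun hab => exists_congr fun θ => ?_
  rw [expGate_eq_rotor hab]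

end Gamma

/-! ### Products of two Clifford matrices span the matrix algebra -/

section EvenSubalgebra

lemma qubitTensor_cliffordAux_mul_cliffordAux {ℓ i j : ℕ} (hi : i < 2 * ℓ + 1)
    (hj : j < 2 * ℓ + 1) : qubitTensor 1 (cliffordAux ℓ i * cliffordAux ℓ j)
      = cliffordAux (ℓ + 1) i * cliffordAux (ℓ + 1) j := by
  rw [cliffordAux, cliffordAux, if_pos hi, if_pos hj, qubitTensor_mul, pauli_mul_self]

open scoped TensorProduct in
lemma qubitTensor_one_mem_of_adjoin_eq_top {ℓ : ℕ} {S : Set (Matrix (Qubits ℓ) (Qubits ℓ) ℂ)}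
    (hS : Algebra.adjoin ℂ S = ⊤)
    {A : Subalgebra ℂ (Matrix (Qubits (ℓ + 1)) (Qubits (ℓ + 1)) ℂ)}
    (hA : ∀ M ∈ S, qubitTensor 1 M ∈ A) (M : Matrix (Qubits ℓ) (Qubits ℓ) ℂ) :
    qubitTensor 1 M ∈ A := by
  let f : Matrix (Qubits ℓ) (Qubits ℓ) ℂ →ₐ[ℂ] Matrix (Qubits (ℓ + 1)) (Qubits (ℓ + 1)) ℂ :=
    (qubitTensorEquiv ℓ).toAlgHom.comp Algebra.TensorProduct.includeRight
  have hf : ∀ N, f N = qubitTensor 1 N := fun N => qubitTensorEquiv_tmul 1 N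
  have hle : Algebra.adjoin ℂ S ≤ A.comap f := Algebra.adjoin_le fun N hN => by
    rw [SetLike.mem_coe, Subalgebra.mem_comap, hf]
    exact hA N hN
  rw [hS] at hle
  exact hf M ▸ hle Algebra.mem_top

lemma qubitTensor_mem_of_forall_pauli_mem {ℓ : ℕ} {M : Matrix (Qubits ℓ) (Qubits ℓ) ℂ}
    {A : Submodule ℂ (Matrix (Qubits (ℓ + 1)) (Qubits (ℓ + 1)) ℂ)}
    (hA : ∀ i, qubitTensor (pauli i) M ∈ A) (P : Matrix (Fin 2) (Fin 2) ℂ) :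
    qubitTensor P M ∈ A := by
  let f : Matrix (Fin 2) (Fin 2) ℂ →ₗ[ℂ] Matrix (Qubits (ℓ + 1)) (Qubits (ℓ + 1)) ℂ :=
    (qubitTensorEquiv ℓ).toLinearMap ∘ₗ (TensorProduct.mk ℂ _ _).flip M
  have hf : ∀ Q, f Q = qubitTensor Q M := fun Q => qubitTensorEquiv_tmul Q M
  have hle : Submodule.span ℂ (Set.range pauli) ≤ A.comap f := Submodule.span_le.2 <| by
    rintro _ ⟨i, rfl⟩
    rw [SetLike.mem_coe, Submodule.mem_comap, hf]
    exact hA i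
  rw [span_range_pauli] at hle
  exact hf P ▸ hle Submodule.mem_top

/-- The products of two Clifford matrices. Those with equal indices are the identity. -/
def gammaProducts (ℓ : ℕ) : Set (Matrix (Qubits ℓ) (Qubits ℓ) ℂ) :=
  {M | ∃ a b, M = gamma ℓ a * gamma ℓ b}

lemma cliffordAux_mul_cliffordAux_mem_adjoin_gammaProducts {ℓ i j : ℕ} (hi : i < 2 * ℓ + 1)
    (hj : j < 2 * ℓ + 1) :
    cliffordAux ℓ i * cliffordAux ℓ j ∈ Algebra.adjoin ℂ (gammaProducts ℓ) :=
  Algebra.subset_adjoin ⟨⟨i, hi⟩, ⟨j, hj⟩, rfl⟩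

lemma qubitTensor_pauli_mem_adjoin_gammaProducts {ℓ : ℕ}
    (hright : ∀ M, qubitTensor 1 M ∈ Algebra.adjoin ℂ (gammaProducts (ℓ + 1))) (i : Fin 4) :
    qubitTensor (pauli i) 1 ∈ Algebra.adjoin ℂ (gammaProducts (ℓ + 1)) := by
  have hX : cliffordAux (ℓ + 1) 0 = qubitTensor (pauli 1) (cliffordAux ℓ 0) :=
    if_pos (Nat.succ_pos _)
  have hY : cliffordAux (ℓ + 1) (2 * ℓ + 1) = qubitTensor (pauli 2) 1 := by simp [cliffordAux]
  have hZ : cliffordAux (ℓ + 1) (2 * ℓ + 2) = qubitTensor (pauli 3) 1 := by simp [cliffordAux]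
  have hcancel : ∀ {P M}, M * M = 1 →
      Complex.I • qubitTensor P M ∈ Algebra.adjoin ℂ (gammaProducts (ℓ + 1)) →
      qubitTensor P 1 ∈ Algebra.adjoin ℂ (gammaProducts (ℓ + 1)) := fun {P M} hM h => by
    have hmul := Subalgebra.smul_mem _ (mul_mem h (hright M)) (-Complex.I)
    rwa [smul_mul_assoc, qubitTensor_mul, hM, mul_one, smul_smul, neg_mul, Complex.I_mul_I,
      neg_neg, one_smul] at hmul
  have hYZ := cliffordAux_mul_cliffordAux_mem_adjoin_gammaProducts (ℓ := ℓ + 1)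
    (i := 2 * ℓ + 1) (j := 2 * ℓ + 2) (by omega) (by omega)
  have hZX := cliffordAux_mul_cliffordAux_mem_adjoin_gammaProducts (ℓ := ℓ + 1)
    (i := 2 * ℓ + 2) (j := 0) (by omega) (by omega)
  have hXY := cliffordAux_mul_cliffordAux_mem_adjoin_gammaProducts (ℓ := ℓ + 1)
    (i := 0) (j := 2 * ℓ + 1) (by omega) (by omega)
  rw [hY, hZ, qubitTensor_mul, pauli_two_mul_three, qubitTensor_smul_left, mul_one] at hYZ
  rw [hZ, hX, qubitTensor_mul, pauli_three_mul_one, qubitTensor_smul_left, one_mul] at hZX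
  rw [hX, hY, qubitTensor_mul, pauli_one_mul_two, qubitTensor_smul_left, mul_one] at hXY
  fin_cases i
  exacts [hright 1, hcancel (mul_one 1) hYZ, hcancel (cliffordAux_mul_self ℓ 0) hZX,
    hcancel (cliffordAux_mul_self ℓ 0) hXY]

theorem adjoin_gammaProducts (ℓ : ℕ) : Algebra.adjoin ℂ (gammaProducts ℓ) = ⊤ := by
  induction ℓ with
  | zero =>
    refine eq_top_iff.2 fun M _ => ?_
    have hM : M = algebraMap ℂ _ (M default default) := by
      ext x y
      rw [Subsingleton.elim x default, Subsingleton.elim y default, algebraMap_matrix_apply,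
        if_pos rfl]
      rfl
    exact hM ▸ Subalgebra.algebraMap_mem _ _
  | succ ℓ ih =>
    have hright : ∀ M, qubitTensor 1 M ∈ Algebra.adjoin ℂ (gammaProducts (ℓ + 1)) := by
      refine qubitTensor_one_mem_of_adjoin_eq_top ih ?_
      rintro _ ⟨a, b, rfl⟩
      rw [gamma, gamma, qubitTensor_cliffordAux_mul_cliffordAux a.2 b.2]
      exact cliffordAux_mul_cliffordAux_mem_adjoin_gammaProducts (by omega) (by omega)
    exact eq_top_of_forall_qubitTensor_mem (qubitTensor_mem_of_forall_pauli_mem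
      (A := (Algebra.adjoin ℂ (gammaProducts (ℓ + 1))).toSubmodule)
      (qubitTensor_pauli_mem_adjoin_gammaProducts hright)) hright

end EvenSubalgebra

/-! ### Charge conjugation -/

section ChargeConjugation

/-- The charge conjugation matrix, which intertwines the Clifford matrices with their transposes
up to a sign. -/
def chargeConj : (ℓ : ℕ) → Matrix (Qubits ℓ) (Qubits ℓ) ℂ
  | 0 => 1
  | ℓ + 1 => qubitTensor (if Even ℓ then pauli 2 else pauli 3) (chargeConj ℓ)

lemma chargeConj_mul_self (ℓ : ℕ) : chargeConj ℓ * chargeConj ℓ = 1 := by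
  induction ℓ with
  | zero => exact one_mul 1
  | succ ℓ ih =>
    rw [chargeConj, qubitTensor_mul, ih]
    split_ifs <;> rw [pauli_mul_self, qubitTensor_one]

lemma chargeConj_ne_zero (ℓ : ℕ) : chargeConj ℓ ≠ 0 := fun h => by
  simpa [h] using chargeConj_mul_self ℓ

lemma chargeConj_mul_cliffordAux_transpose (ℓ i : ℕ) :
    chargeConj ℓ * (cliffordAux ℓ i)ᵀ = (-1 : ℂ) ^ ℓ • (cliffordAux ℓ i * chargeConj ℓ) := by
  have hX : (pauli 1)ᵀ = pauli 1 := by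
    ext x y; fin_cases x <;> fin_cases y <;> simp [pauli]
  have hY : (pauli 2)ᵀ = -pauli 2 := by
    ext x y; fin_cases x <;> fin_cases y <;> simp [pauli]
  have hZ : (pauli 3)ᵀ = pauli 3 := by
    ext x y; fin_cases x <;> fin_cases y <;> simp [pauli]
  have h12 := pauli_anticomm (i := 1) (j := 2) (by decide) (by decide) (by decide)
  have h13 := pauli_anticomm (i := 1) (j := 3) (by decide) (by decide) (by decide)
  have h23 := pauli_anticomm (i := 2) (j := 3) (by decide) (by decide) (by decide)
  induction ℓ generalizing i with
  | zero => simp [cliffordAux]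
  | succ ℓ ih =>
    simp only [cliffordAux, chargeConj]
    rcases Nat.even_or_odd ℓ with hℓ | hℓ
    · rw [if_pos hℓ, hℓ.add_one.neg_one_pow]
      split_ifs <;> simp only [qubitTensor_transpose, qubitTensor_mul, transpose_one, ih,
        hℓ.neg_one_pow, one_smul, mul_one, one_mul, mul_neg, hX, hY, hZ, h12, h23,
        qubitTensor_neg_left, neg_smul, neg_neg]
    · rw [if_neg (Nat.not_even_iff_odd.2 hℓ), hℓ.add_one.neg_one_pow]
      split_ifs <;> simp only [qubitTensor_transpose, qubitTensor_mul, transpose_one, ih,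
        hℓ.neg_one_pow, one_smul, mul_one, one_mul, mul_neg, hX, hY, hZ, h13, h23,
        qubitTensor_neg_left, qubitTensor_neg_right, neg_smul]

variable {ℓ : ℕ}

lemma chargeConj_mul_gamma_mul_gamma_transpose (a b : Fin (2 * ℓ + 1)) :
    chargeConj ℓ * (gamma ℓ a * gamma ℓ b)ᵀ = gamma ℓ b * gamma ℓ a * chargeConj ℓ := by
  rw [transpose_mul, ← mul_assoc, gamma, gamma, chargeConj_mul_cliffordAux_transpose,
    smul_mul_assoc, mul_assoc, chargeConj_mul_cliffordAux_transpose, mul_smul_comm, smul_smul,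
    ← mul_pow, neg_one_mul, neg_neg, one_pow, one_smul, mul_assoc]

end ChargeConjugation

/-! ### The spin group as a double cover -/

section SpinGroup

section FormStabilizer

variable {κ : Type*} [Fintype κ] [DecidableEq κ] {C : Matrix κ κ ℂ}

/-- The unitaries that preserve the bilinear form which the matrix `C` defines on row vectors. -/
def formStabilizer (C : Matrix κ κ ℂ) : Subgroup (unitaryGroup κ ℂ) where
  carrier := {V | V.1 * C * V.1ᵀ = C}
  one_mem' := by simp
  mul_mem' {V W} hV hW :=
    calc (V.1 * W.1) * C * (V.1 * W.1)ᵀ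
        = V.1 * (W.1 * C * W.1ᵀ) * V.1ᵀ := by simp only [transpose_mul, mul_assoc]
      _ = C := by rw [hW, hV]
  inv_mem' {V} hV := by
    have hinv : star V.1 * V.1 = 1 := Unitary.coe_star_mul_self V
    calc star V.1 * C * (star V.1)ᵀ
        = star V.1 * (V.1 * C * V.1ᵀ) * (star V.1)ᵀ := by rw [hV]
      _ = (star V.1 * V.1) * C * (star V.1 * V.1)ᵀ := by simp only [transpose_mul, mul_assoc]
      _ = C := by rw [hinv, transpose_one, one_mul, mul_one]

lemma isClosed_formStabilizer : IsClosed (formStabilizer C : Set (unitaryGroup κ ℂ)) :=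
  isClosed_eq ((continuous_subtype_val.matrix_mul continuous_const).matrix_mul
    continuous_subtype_val.matrix_transpose) continuous_const

lemma eq_one_or_eq_neg_one_of_mem_formStabilizer (hC : C ≠ 0) {V : unitaryGroup κ ℂ}
    (hV : V ∈ formStabilizer C) {c : ℂ} (hc : V.1 = c • 1) : V = 1 ∨ V = -1 := by
  have hV : V.1 * C * V.1ᵀ = C := hV
  rw [hc, transpose_smul, transpose_one, mul_smul_comm, mul_one, smul_mul_assoc, one_mul,
    smul_smul] at hV
  have hcc : c * c = 1 := smul_left_injective ℂ hC (hV.trans (one_smul ℂ C).symm)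
  refine (mul_self_eq_one_iff.1 hcc).imp (fun h => Subtype.ext ?_) fun h => Subtype.ext ?_
  · rw [hc, h, one_smul]
    rfl
  · rw [hc, h, neg_one_smul]
    rfl

end FormStabilizer

/-- The group generated by the unitaries `exp(-i θ Γ^{ab})`. -/
abbrev spinGroup (ℓ : ℕ) : Subgroup (unitaryGroup (Qubits ℓ) ℂ) := rotorGroup (gamma ℓ)

/-- The covering homomorphism from the spin group to `SO(2ℓ+1)`. -/
abbrev spinHom (ℓ : ℕ) : spinGroup ℓ →* SO ℓ := rotorHom isCliffordFamily_gamma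

variable {ℓ : ℕ}

lemma mem_intertwiners_gamma_one_iff {V : unitaryGroup (Qubits ℓ) ℂ} :
    (V, 1) ∈ intertwiners (gamma ℓ) ↔ ∃ c : ℂ, V.1 = c • (1 : Matrix (Qubits ℓ) (Qubits ℓ) ℂ) := by
  rw [mem_intertwiners_one_iff]
  refine ⟨fun h => exists_eq_smul_one_of_commute_of_adjoin_eq_top (adjoin_gammaProducts ℓ) ?_, ?_⟩
  · rintro _ ⟨a, b, rfl⟩
    exact ((h a).mul_right (h b)).symm
  · rintro ⟨c, hc⟩ a
    exact hc ▸ (Commute.one_left _).smul_left c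

lemma spinGroup_le_formStabilizer_chargeConj : spinGroup ℓ ≤ formStabilizer (chargeConj ℓ) := by
  refine (Subgroup.closure_le _).2 ?_
  rintro V ⟨a, b, hab, θ, hV⟩
  have hΓ := isCliffordFamily_gamma (ℓ := ℓ)
  have hrotor : chargeConj ℓ * (rotor (gamma ℓ a * gamma ℓ b) θ)ᵀ
      = rotor (gamma ℓ a * gamma ℓ b) (-θ) * chargeConj ℓ := by
    simp only [rotor, transpose_sub, transpose_smul, transpose_one, mul_sub, sub_mul,
      mul_smul_comm, smul_mul_assoc, mul_one, one_mul, chargeConj_mul_gamma_mul_gamma_transpose,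
      hΓ.anticomm hab.symm, Real.cos_neg, Real.sin_neg, neg_mul, smul_neg, neg_smul]
  change V.1 * chargeConj ℓ * V.1ᵀ = chargeConj ℓ
  rw [hV, mul_assoc, hrotor, ← mul_assoc, rotor_mul_rotor (hΓ.bivector_mul_self hab),
    add_neg_cancel, rotor_zero, one_mul]

lemma exists_mem_spinGroup_eq_expGate {a b : Fin (2 * ℓ + 1)} (hab : a ≠ b) (θ : ℝ) :
    ∃ V ∈ spinGroup ℓ, V.1 = expGate a b θ :=
  ⟨⟨_, rotor_mem_unitary (isCliffordFamily_gamma.bivector_mul_self hab)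
      (isCliffordFamily_gamma.star_bivector hab) θ⟩,
    Subgroup.subset_closure ⟨a, b, hab, θ, rfl⟩, (expGate_eq_rotor hab θ).symm⟩

lemma neg_one_mem_spinGroup (hℓ : 1 ≤ ℓ) : -1 ∈ spinGroup ℓ :=
  Subgroup.subset_closure
    ⟨⟨0, by omega⟩, ⟨1, by omega⟩, by simp, Real.pi, rotor_pi.symm⟩

theorem spinHom_eq_one_iff_exists_smul {V : spinGroup ℓ} :
    spinHom ℓ V = 1 ↔ ∃ c : ℂ, V.1.1 = c • (1 : Matrix (Qubits ℓ) (Qubits ℓ) ℂ) := by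
  rw [rotorHom_eq_iff, mem_intertwiners_gamma_one_iff]

theorem spinHom_eq_one_iff {V : spinGroup ℓ} : spinHom ℓ V = 1 ↔ V.1.1 = 1 ∨ V.1.1 = -1 := by
  rw [spinHom_eq_one_iff_exists_smul]
  refine ⟨fun ⟨c, hc⟩ => ?_, ?_⟩
  · have h := eq_one_or_eq_neg_one_of_mem_formStabilizer (chargeConj_ne_zero ℓ)
      (spinGroup_le_formStabilizer_chargeConj V.2) hc
    exact h.imp (congrArg Subtype.val) (congrArg Subtype.val)
  · rintro (h | h)
    exacts [⟨1, by rw [h, one_smul]⟩, ⟨-1, by rw [h, neg_one_smul]⟩]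

lemma mem_spinGroup_iff (hℓ : 1 ≤ ℓ) {V : unitaryGroup (Qubits ℓ) ℂ} :
    V ∈ spinGroup ℓ ↔
      V ∈ formStabilizer (chargeConj ℓ) ∧ ∃ g, (V, g) ∈ intertwiners (gamma ℓ) := by
  refine ⟨fun hV => ⟨spinGroup_le_formStabilizer_chargeConj hV,
    exists_mem_intertwiners isCliffordFamily_gamma hV⟩, fun ⟨hV, g, hg⟩ => ?_⟩
  obtain ⟨W, rfl⟩ := rotorHom_surjective isCliffordFamily_gamma g
  have hquot : (V * W.1⁻¹, 1) ∈ intertwiners (gamma ℓ) := by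
    simpa only [Prod.inv_mk, Prod.mk_mul_mk, mul_inv_cancel] using
      mul_mem hg (inv_mem (rotorHom_mem_intertwiners isCliffordFamily_gamma W))
  obtain ⟨c, hc⟩ := mem_intertwiners_gamma_one_iff.1 hquot
  refine ((spinGroup ℓ).mul_mem_cancel_right (inv_mem W.2)).1 ?_
  rcases eq_one_or_eq_neg_one_of_mem_formStabilizer (chargeConj_ne_zero ℓ)
    (mul_mem hV (inv_mem (spinGroup_le_formStabilizer_chargeConj W.2))) hc with h | h
  · exact h ▸ one_mem _
  · exact h ▸ neg_one_mem_spinGroup hℓ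

lemma isClosed_spinGroup (hℓ : 1 ≤ ℓ) :
    IsClosed (spinGroup ℓ : Set (unitaryGroup (Qubits ℓ) ℂ)) := by
  have hset : (spinGroup ℓ : Set (unitaryGroup (Qubits ℓ) ℂ))
      = (formStabilizer (chargeConj ℓ) : Set (unitaryGroup (Qubits ℓ) ℂ)) ∩
        Prod.fst '' (intertwiners (gamma ℓ) : Set (unitaryGroup (Qubits ℓ) ℂ × SO ℓ)) := by
    ext V
    simp [mem_spinGroup_iff hℓ]
  rw [hset]
  exact isClosed_formStabilizer.inter (isClosedMap_fst_of_compactSpace _ isClosed_intertwiners)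

theorem isQuotientMap_spinHom (hℓ : 1 ≤ ℓ) : Topology.IsQuotientMap (spinHom ℓ) := by
  have : CompactSpace (spinGroup ℓ) :=
    isCompact_iff_compactSpace.1 (isClosed_spinGroup hℓ).isCompact
  have hcont := continuous_rotorHom (isCliffordFamily_gamma (ℓ := ℓ))
  exact hcont.isClosedMap.isQuotientMap hcont (rotorHom_surjective isCliffordFamily_gamma)

end SpinGroup

/-! ### Sums over ordered pairs -/

section OrderedPairs

variable {ι : Type*} [LinearOrder ι]

lemma not_fst_eq_snd_and_snd_eq_fst (p q : {p : ι × ι // p.1 < p.2}) :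
    ¬(p.1.1 = q.1.2 ∧ p.1.2 = q.1.1) := fun ⟨h₁, h₂⟩ =>
  (h₁ ▸ h₂ ▸ p.2 : q.1.2 < q.1.1).not_gt q.2

lemma eq_iff_fst_eq_and_snd_eq {p q : {p : ι × ι // p.1 < p.2}} :
    p = q ↔ p.1.1 = q.1.1 ∧ p.1.2 = q.1.2 := by
  rw [Subtype.ext_iff, Prod.ext_iff]

/-- Exactly one of the two indices of the pair `p` lies in `s`. -/
def Crosses (s : Finset ι) (p : {p : ι × ι // p.1 < p.2}) : Prop :=
  Xor (p.1.1 ∈ s) (p.1.2 ∈ s)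

section Clifford

variable {A : Type*} [Ring A] [StarRing A] {Γ : ι → A} {a b i : ι}

lemma IsCliffordFamily.bivector_mul_of_mem (hΓ : IsCliffordFamily Γ) (hab : a ≠ b)
    (hi : i ∈ ({a, b} : Finset ι)) : Γ a * Γ b * Γ i = -(Γ i * (Γ a * Γ b)) := by
  rcases Finset.mem_insert.1 hi with rfl | hi
  · exact hΓ.bivector_mul_left hab
  · obtain rfl := Finset.mem_singleton.1 hi
    exact hΓ.bivector_mul_right hab

lemma IsCliffordFamily.commute_bivector_of_notMem (hΓ : IsCliffordFamily Γ)
    (hi : i ∉ ({a, b} : Finset ι)) : Commute (Γ a * Γ b) (Γ i) := by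
  simp only [Finset.mem_insert, Finset.mem_singleton, not_or] at hi
  exact hΓ.commute_bivector (Ne.symm hi.1) (Ne.symm hi.2)

variable {p : {p : ι × ι // p.1 < p.2}}

lemma IsCliffordFamily.bivector_mul_bivector_of_crosses (hΓ : IsCliffordFamily Γ) (hab : a ≠ b)
    (hp : Crosses {a, b} p) :
    Γ a * Γ b * (Γ p.1.1 * Γ p.1.2) = -(Γ p.1.1 * Γ p.1.2 * (Γ a * Γ b)) := by
  rcases hp with ⟨h₁, h₂⟩ | ⟨h₂, h₁⟩
  · rw [← mul_assoc, hΓ.bivector_mul_of_mem hab h₁, neg_mul, mul_assoc,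
      (hΓ.commute_bivector_of_notMem h₂).eq, mul_assoc]
  · rw [← mul_assoc, (hΓ.commute_bivector_of_notMem h₁).eq, mul_assoc,
      hΓ.bivector_mul_of_mem hab h₂, mul_neg, mul_assoc]

lemma IsCliffordFamily.commute_bivector_bivector_of_not_crosses (hΓ : IsCliffordFamily Γ)
    (hab : a ≠ b) (hp : ¬Crosses {a, b} p) : Commute (Γ a * Γ b) (Γ p.1.1 * Γ p.1.2) := by
  have hmem := (not_xor _ _).1 hp
  by_cases h₁ : p.1.1 ∈ ({a, b} : Finset ι)
  · rw [commute_iff_eq, ← mul_assoc, hΓ.bivector_mul_of_mem hab h₁, neg_mul, mul_assoc,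
      hΓ.bivector_mul_of_mem hab (hmem.1 h₁), mul_neg, neg_neg, mul_assoc]
  · exact (hΓ.commute_bivector_of_notMem h₁).mul_right
      (hΓ.commute_bivector_of_notMem (mt hmem.2 h₁))

end Clifford

variable [Fintype ι]

lemma sum_lt_eq_sum_sum_ite {M : Type*} [AddCommMonoid M] (f : ι → ι → M) :
    ∑ p : {p : ι × ι // p.1 < p.2}, f p.1.1 p.1.2 = ∑ m, ∑ n, if m < n then f m n else 0 := by
  rw [← Fintype.sum_prod_type' fun m n => if m < n then f m n else 0, ← Finset.sum_filter]
  exact (Finset.sum_subtype _ (by simp) fun x : ι × ι => f x.1 x.2).symm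

lemma sum_sum_eq_sum_lt_add_sum_diag {M : Type*} [AddCommMonoid M] (f : ι → ι → M) :
    ∑ m, ∑ n, f m n
      = ∑ p : {p : ι × ι // p.1 < p.2}, (f p.1.1 p.1.2 + f p.1.2 p.1.1) + ∑ m, f m m := by
  have hsplit : ∀ m n, f m n
      = (if m < n then f m n else 0) + (if n < m then f m n else 0) + if m = n then f m n else 0 :=
    fun m n => by
      rcases lt_trichotomy m n with h | rfl | h
      · simp [h, h.not_gt, h.ne]
      · simp
      · simp [h, h.not_gt, h.ne']
  have hswap : ∑ m, ∑ n, (if n < m then f m n else 0) = ∑ m, ∑ n, if m < n then f n m else 0 :=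
    Finset.sum_comm
  rw [Finset.sum_add_distrib, sum_lt_eq_sum_sum_ite, sum_lt_eq_sum_sum_ite fun m n => f n m,
    ← hswap]
  conv_lhs => enter [2, m, 2, n]; rw [hsplit]
  simp only [Finset.sum_add_distrib, Finset.sum_ite_eq, Finset.mem_univ, if_true]

lemma card_mul_card_eq_two_mul_card_lt_add_card :
    Fintype.card ι * Fintype.card ι
      = 2 * Fintype.card {p : ι × ι // p.1 < p.2} + Fintype.card ι := by
  simpa [mul_comm] using sum_sum_eq_sum_lt_add_sum_diag (ι := ι) fun _ _ => (1 : ℕ)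

open Classical in
lemma card_crosses (s : Finset ι) :
    Fintype.card {p : {p : ι × ι // p.1 < p.2} // Crosses s p} = s.card * sᶜ.card := by
  have h := sum_sum_eq_sum_lt_add_sum_diag (ι := ι) fun m n =>
    (if m ∈ s then 1 else 0) * if n ∈ sᶜ then 1 else 0
  have hdiag : ∀ m, ((if m ∈ s then 1 else 0) * if m ∈ sᶜ then 1 else 0) = 0 := fun m => by
    by_cases hm : m ∈ s <;> simp [hm]
  have hpair : ∀ p : {p : ι × ι // p.1 < p.2},
      ((if p.1.1 ∈ s then 1 else 0) * if p.1.2 ∈ sᶜ then 1 else 0)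
        + ((if p.1.2 ∈ s then 1 else 0) * if p.1.1 ∈ sᶜ then 1 else 0)
        = if Crosses s p then 1 else 0 := fun p => by
    by_cases h₁ : p.1.1 ∈ s <;> by_cases h₂ : p.1.2 ∈ s <;> simp [Crosses, Xor, h₁, h₂]
  simp only [hdiag, hpair, ← Finset.sum_mul_sum, Finset.sum_boole, Finset.sum_const_zero,
    Finset.filter_univ_mem, Nat.cast_id, add_zero] at h
  rw [h, Fintype.card_subtype]

end OrderedPairs

/-! ### The second compound of a matrix -/

section SecondCompound

variable {ι R : Type*} [LinearOrder ι] [CommRing R]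

/-- The matrix of `2 × 2` minors of `M`, which is the matrix of the exterior square of `M`. -/
def secondCompound (M : Matrix ι ι R) :
    Matrix {p : ι × ι // p.1 < p.2} {p : ι × ι // p.1 < p.2} R :=
  of fun p q => M p.1.1 q.1.1 * M p.1.2 q.1.2 - M p.1.1 q.1.2 * M p.1.2 q.1.1

lemma secondCompound_conjTranspose [StarRing R] (M : Matrix ι ι R) :
    secondCompound Mᴴ = (secondCompound M)ᴴ := by
  ext p q
  simp only [secondCompound, of_apply, conjTranspose_apply, star_sub, star_mul]
  ring

lemma secondCompound_smul (c : R) (M : Matrix ι ι R) :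
    secondCompound (c • M) = (c * c) • secondCompound M := by
  ext p q
  simp only [secondCompound, of_apply, Matrix.smul_apply, smul_eq_mul]
  ring

lemma secondCompound_diagonal (d : ι → R) :
    secondCompound (diagonal d) = diagonal fun p => d p.1.1 * d p.1.2 := by
  ext p q
  have hswap := not_fst_eq_snd_and_snd_eq_fst p q
  simp only [secondCompound, of_apply, diagonal_apply, eq_iff_fst_eq_and_snd_eq,
    ite_zero_mul_ite_zero, if_neg hswap, sub_zero]

lemma secondCompound_one : secondCompound (1 : Matrix ι ι R) = 1 := by
  rw [← diagonal_one, secondCompound_diagonal]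
  simp only [mul_one, diagonal_one]

lemma secondCompound_permMatrix_apply {σ : Equiv.Perm ι} {p q : {p : ι × ι // p.1 < p.2}}
    (h₁ : σ q.1.1 = p.1.1) (h₂ : σ q.1.2 = p.1.2) (r : {p : ι × ι // p.1 < p.2}) :
    secondCompound (σ.permMatrix R) r p = if r = q then 1 else 0 := by
  have hswap := not_fst_eq_snd_and_snd_eq_fst r q
  have hentry : ∀ i j, σ.permMatrix R i (σ j) = if i = j then 1 else 0 := fun i j => by
    simp [Equiv.Perm.permMatrix, PEquiv.toMatrix_apply, Equiv.toPEquiv_apply]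
  simp only [secondCompound, of_apply, ← h₁, ← h₂, hentry, ite_zero_mul_ite_zero, if_neg hswap,
    eq_iff_fst_eq_and_snd_eq, sub_zero, mul_one]

variable [Fintype ι]

theorem secondCompound_mul (M N : Matrix ι ι R) :
    secondCompound (M * N) = secondCompound M * secondCompound N := by
  ext p r
  have hdiag : ∀ m,
      M p.1.1 m * M p.1.2 m * (N m r.1.1 * N m r.1.2 - N m r.1.2 * N m r.1.1) = 0 := fun m => by
    ring
  calc secondCompound (M * N) p r
      = ∑ m, ∑ n, M p.1.1 m * M p.1.2 n * (N m r.1.1 * N n r.1.2 - N m r.1.2 * N n r.1.1) := by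
        simp only [secondCompound, of_apply, mul_apply, Finset.sum_mul_sum,
          ← Finset.sum_sub_distrib]
        exact Finset.sum_congr rfl fun m _ => Finset.sum_congr rfl fun n _ => by ring
    _ = ∑ q, secondCompound M p q * secondCompound N q r := by
        rw [sum_sum_eq_sum_lt_add_sum_diag]
        simp only [hdiag, Finset.sum_const_zero, add_zero]
        refine Finset.sum_congr rfl fun q _ => ?_
        simp only [secondCompound, of_apply]
        ring

section Clifford

variable {A : Type*} [Ring A] [StarRing A] {Γ : ι → A}

/-- The diagonal terms of the product cancel when rows `p.1.1` and `p.1.2` of `M` are orthogonal. -/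
lemma sum_smul_mul_sum_smul_eq_sum_secondCompound_smul [Algebra R A] (hΓ : IsCliffordFamily Γ)
    {M : Matrix ι ι R} {p : {p : ι × ι // p.1 < p.2}} (hM : M p.1.1 ⬝ᵥ M p.1.2 = 0) :
    (∑ m, M p.1.1 m • Γ m) * ∑ n, M p.1.2 n • Γ n
      = ∑ q, secondCompound M p q • (Γ q.1.1 * Γ q.1.2) := by
  rw [Finset.sum_mul_sum, sum_sum_eq_sum_lt_add_sum_diag]
  have hdiag : ∑ m, M p.1.1 m • Γ m * M p.1.2 m • Γ m = 0 := by
    simp only [smul_mul_smul_comm, hΓ.mul_self, ← Finset.sum_smul]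
    rw [← dotProduct, hM, zero_smul]
  rw [hdiag, add_zero]
  refine Finset.sum_congr rfl fun q _ => ?_
  rw [smul_mul_smul_comm, smul_mul_smul_comm, hΓ.anticomm q.2.ne', smul_neg, ← sub_eq_add_neg,
    ← sub_smul]
  rfl

theorem star_mul_bivector_mul_of_mem_intertwiners [Algebra ℝ A] (hΓ : IsCliffordFamily Γ)
    {V : unitary A} {g : specialOrthogonalGroup ι ℝ} (hV : (V, g) ∈ intertwiners Γ)
    (p : {p : ι × ι // p.1 < p.2}) :
    star V.1 * (Γ p.1.1 * Γ p.1.2) * V.1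
      = ∑ q, secondCompound g.1 p q • (Γ q.1.1 * Γ q.1.2) := by
  have horth : g.1 p.1.1 ⬝ᵥ g.1 p.1.2 = 0 := by
    have h := (mem_orthogonalGroup_iff _ _).1 (mem_specialOrthogonalGroup_iff.1 g.2).1
    exact (congrFun₂ h p.1.1 p.1.2).trans (one_apply_ne p.2.ne)
  have hunit : V.1 * star V.1 = 1 := Unitary.coe_mul_star_self V
  calc star V.1 * (Γ p.1.1 * Γ p.1.2) * V.1
      = (star V.1 * Γ p.1.1 * V.1) * (star V.1 * Γ p.1.2 * V.1) := by
        simp only [← mul_assoc]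
        rw [mul_assoc _ V.1, hunit, mul_one]
    _ = ∑ q, secondCompound g.1 p q • (Γ q.1.1 * Γ q.1.2) := by
        rw [hV, hV, sum_smul_mul_sum_smul_eq_sum_secondCompound_smul hΓ horth]

end Clifford

end SecondCompound

/-! ### The adjoint representation -/

section Adjoint

variable {ℓ : ℕ}

lemma adjoint_eq_map_secondCompound (g : SO ℓ) :
    adjoint g = (secondCompound g.1).map (algebraMap ℝ ℂ) := rfl

lemma adjoint_one : adjoint (1 : SO ℓ) = 1 := by
  rw [adjoint_eq_map_secondCompound, Submonoid.coe_one, secondCompound_one,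
    Matrix.map_one _ (map_zero _) (map_one _)]

lemma adjoint_mul (g h : SO ℓ) : adjoint (g * h) = adjoint g * adjoint h := by
  simp only [adjoint_eq_map_secondCompound, Submonoid.coe_mul, secondCompound_mul, Matrix.map_mul]

lemma adjoint_inv (g : SO ℓ) : adjoint g⁻¹ = (adjoint g)ᴴ := by
  have hinv : g⁻¹.1 = g.1ᴴ := rfl
  rw [adjoint_eq_map_secondCompound, hinv, secondCompound_conjTranspose]
  exact conjTranspose_map _ fun x => (Complex.conj_ofReal x).symm

lemma adjoint_mem_unitaryGroup (g : SO ℓ) : adjoint g ∈ unitaryGroup (Pair ℓ) ℂ := by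
  rw [mem_unitaryGroup_iff, star_eq_conjTranspose, ← adjoint_inv, ← adjoint_mul, mul_inv_cancel,
    adjoint_one]

/-- The adjoint representation as a homomorphism to the unitary group. -/
def adjointHom (ℓ : ℕ) : SO ℓ →* unitaryGroup (Pair ℓ) ℂ :=
  MonoidHom.mk' (fun g => ⟨adjoint g, adjoint_mem_unitaryGroup g⟩) fun g h =>
    Subtype.ext (adjoint_mul g h)

/-- In odd dimension `det g • g` is a rotation, so that reflections act on bivectors too. -/
lemma exists_adjoint_eq_map_secondCompound {g : Matrix (Fin (2 * ℓ + 1)) (Fin (2 * ℓ + 1)) ℝ}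
    (hg : g * gᵀ = 1) : ∃ h : SO ℓ, adjoint h = (secondCompound g).map (algebraMap ℝ ℂ) := by
  have hdet : g.det * g.det = 1 := by
    simpa only [det_mul, det_transpose, det_one] using congrArg det hg
  have horth : g.det • g ∈ orthogonalGroup (Fin (2 * ℓ + 1)) ℝ := by
    rw [mem_orthogonalGroup_iff, transpose_smul, smul_mul_smul_comm, hdet, one_smul, hg]
  refine ⟨⟨g.det • g, mem_specialOrthogonalGroup_iff.2 ⟨horth, ?_⟩⟩, ?_⟩
  · rw [det_smul, Fintype.card_fin, pow_succ, pow_mul, sq, hdet, one_pow, one_mul, hdet]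
  · rw [adjoint_eq_map_secondCompound, secondCompound_smul, hdet, one_smul]

section InvariantSubspace

variable {E : Submodule ℂ (Pair ℓ → ℂ)} {v : Pair ℓ → ℂ} {p : Pair ℓ}

lemma indicator_mem_of_adjoint_mulVec_mem (hE : ∀ g : SO ℓ, ∀ v ∈ E, adjoint g *ᵥ v ∈ E)
    (hv : v ∈ E) (c : Fin (2 * ℓ + 1)) : {q : Pair ℓ | q.1.1 = c ∨ q.1.2 = c}.indicator v ∈ E := by
  classical
  let d : Fin (2 * ℓ + 1) → ℝ := fun i => if i = c then -1 else 1
  have hd : diagonal d * (diagonal d)ᵀ = 1 := by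
    rw [diagonal_transpose, diagonal_mul_diagonal, ← diagonal_one]
    exact congrArg diagonal (funext fun i => by by_cases hi : i = c <;> simp [d, hi])
  obtain ⟨h, hh⟩ := exists_adjoint_eq_map_secondCompound hd
  have hhalf : (1 / 2 : ℂ) • (v - adjoint h *ᵥ v)
      = {q : Pair ℓ | q.1.1 = c ∨ q.1.2 = c}.indicator v := by
    funext q
    rw [hh, secondCompound_diagonal, diagonal_map (map_zero _), Pi.smul_apply, Pi.sub_apply,
      mulVec_diagonal]
    have hq := q.2.ne
    by_cases h₁ : q.1.1 = c <;> by_cases h₂ : q.1.2 = c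
    · exact absurd (h₁.trans h₂.symm) hq
    all_goals simp [d, h₁, h₂, Set.indicator]
    all_goals ring
  exact hhalf ▸ E.smul_mem _ (E.sub_mem hv (hE h v hv))

lemma single_mem_of_adjoint_mulVec_mem (hE : ∀ g : SO ℓ, ∀ v ∈ E, adjoint g *ᵥ v ∈ E)
    (hv : v ∈ E) (hp : v p ≠ 0) : Pi.single p 1 ∈ E := by
  classical
  have hmem := indicator_mem_of_adjoint_mulVec_mem hE
    (indicator_mem_of_adjoint_mulVec_mem hE hv p.1.1) p.1.2
  rw [Set.indicator_indicator] at hmem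
  have hset : {q : Pair ℓ | q.1.1 = p.1.2 ∨ q.1.2 = p.1.2} ∩ {q | q.1.1 = p.1.1 ∨ q.1.2 = p.1.1}
      = {p} := by
    ext ⟨⟨a, b⟩, hab⟩
    obtain ⟨⟨c, d⟩, hcd⟩ := p
    simp only [Set.mem_inter_iff, Set.mem_ofPred_eq, Set.mem_singleton_iff, Subtype.mk.injEq,
      Prod.mk.injEq]
    dsimp only at hab hcd
    omega
  have hsingle : Set.indicator {p} v = v p • Pi.single p 1 := by
    funext q
    by_cases hq : q = p <;> simp [hq]
  rwa [hset, hsingle, E.smul_mem_iff hp] at hmem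

lemma single_mem_of_single_mem (hE : ∀ g : SO ℓ, ∀ v ∈ E, adjoint g *ᵥ v ∈ E)
    (hp : Pi.single p 1 ∈ E) (q : Pair ℓ) : Pi.single q 1 ∈ E := by
  have htrans := Equiv.Perm.isMultiplyPretransitive (Fin (2 * ℓ + 1)) 2
  obtain ⟨σ, h₁, h₂⟩ := MulAction.is_two_pretransitive_iff.1 htrans q.2.ne p.2.ne
  obtain ⟨h, hh⟩ := exists_adjoint_eq_map_secondCompound (g := σ.permMatrix ℝ) (by
    rw [transpose_permMatrix, ← permMatrix_mul, inv_mul_cancel, permMatrix_one])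
  have hmul : adjoint h *ᵥ Pi.single p 1 = Pi.single q 1 := by
    funext r
    rw [hh, mulVec_single_one, col_apply, map_apply, secondCompound_permMatrix_apply h₁ h₂,
      Pi.single_apply, apply_ite (algebraMap ℝ ℂ), map_one, map_zero]
  exact hmul ▸ hE h _ hp

end InvariantSubspace

theorem actsIrreducibly_range_adjoint (hℓ : 1 ≤ ℓ) :
    ActsIrreducibly (Set.range (adjoint (ℓ := ℓ))) := by
  refine ⟨⟨⟨(⟨0, by omega⟩, ⟨1, by omega⟩), Fin.mk_lt_mk.2 Nat.one_pos⟩⟩, fun E hE => ?_⟩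
  have hE : ∀ g : SO ℓ, ∀ v ∈ E, adjoint g *ᵥ v ∈ E := fun g => hE _ ⟨g, rfl⟩
  refine or_iff_not_imp_left.2 fun hbot => eq_top_iff.2 fun w _ => ?_
  obtain ⟨v, hv, hv0⟩ := E.ne_bot_iff.1 hbot
  obtain ⟨p, hp : v p ≠ 0⟩ := Function.ne_iff.1 hv0
  rw [pi_eq_sum_univ' w]
  exact E.sum_mem fun q _ => E.smul_mem _ <|
    single_mem_of_single_mem hE (single_mem_of_adjoint_mulVec_mem hE hv hp) q

lemma rotatedKraus_pairOp_spinHom (V : spinGroup ℓ) (p : Pair ℓ) :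
    rotatedKraus pairOp (adjoint (spinHom ℓ V)) p = V.1.1ᴴ * pairOp p * V.1.1 := by
  have h := star_mul_bivector_mul_of_mem_intertwiners isCliffordFamily_gamma
    (rotorHom_mem_intertwiners isCliffordFamily_gamma V) p
  simp only [pairOp, gammaPair, mul_smul_comm, smul_mul_assoc]
  rw [← star_eq_conjTranspose, h]
  simp only [rotatedKraus, pairOp, gammaPair, Finset.smul_sum]
  refine Finset.sum_congr rfl fun q _ => ?_
  rw [adjoint_eq_map_secondCompound, map_apply, algebraMap_smul, smul_comm]

lemma rotatedKraus_smul {ι κ : Type} [Fintype ι] (c : ℂ) (A : ι → Matrix κ κ ℂ)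
    (W : Matrix ι ι ℂ) (i : ι) :
    rotatedKraus (fun j => c • A j) W i = c • rotatedKraus A W i := by
  simp only [rotatedKraus, Finset.smul_sum, smul_comm c]

lemma rotatedKraus_akltTensor (W : Matrix (Pair ℓ) (Pair ℓ) ℂ) (p : Pair ℓ) :
    rotatedKraus (akltTensor ℓ) W p = (krausNorm ℓ : ℂ) • rotatedKraus pairOp W p :=
  rotatedKraus_smul _ pairOp W p

theorem rotatedKraus_akltTensor_spinHom (V : spinGroup ℓ) (p : Pair ℓ) :
    rotatedKraus (akltTensor ℓ) (adjoint (spinHom ℓ V)) p = V.1.1ᴴ * akltTensor ℓ p * V.1.1 := by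
  rw [rotatedKraus_akltTensor, rotatedKraus_pairOp_spinHom, akltTensor, mul_smul_comm,
    smul_mul_assoc]

end Adjoint

/-! ### Born probabilities -/

section Born

variable {ι κ : Type} [Fintype ι] [Fintype κ]

lemma ofReal_normSq (ψ : κ → ℂ) : (normSq ψ : ℂ) = star ψ ⬝ᵥ ψ := by
  simp only [normSq, dotProduct, Pi.star_apply, Complex.star_def, Complex.ofReal_sum,
    Complex.ofReal_pow, Complex.conj_mul']

lemma normSq_smul (c : ℂ) (ψ : κ → ℂ) : normSq (c • ψ) = ‖c‖ ^ 2 * normSq ψ := by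
  simp only [normSq, Finset.mul_sum, Pi.smul_apply, smul_eq_mul, norm_mul, mul_pow]

lemma normSq_mulVec_of_conjTranspose_mul_self [DecidableEq κ] {U : Matrix κ κ ℂ} (hU : Uᴴ * U = 1)
    (ψ : κ → ℂ) : normSq (U *ᵥ ψ) = normSq ψ := by
  rw [← Complex.ofReal_inj, ofReal_normSq, ofReal_normSq, star_mulVec, dotProduct_mulVec,
    vecMul_vecMul, hU, vecMul_one]

lemma rotatedKraus_mulVec_apply (A : ι → Matrix κ κ ℂ) (W : Matrix ι ι ℂ) (ψ : κ → ℂ) (i : ι)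
    (x : κ) : (rotatedKraus A W i *ᵥ ψ) x = (W *ᵥ fun j => (A j *ᵥ ψ) x) i := by
  simp only [rotatedKraus, sum_mulVec, smul_mulVec, Finset.sum_apply, Pi.smul_apply, smul_eq_mul]
  rfl

lemma sum_normSq_rotatedKraus_mulVec [DecidableEq ι] {W : Matrix ι ι ℂ}
    (hW : W ∈ unitaryGroup ι ℂ) (A : ι → Matrix κ κ ℂ) (ψ : κ → ℂ) :
    ∑ i, normSq (rotatedKraus A W i *ᵥ ψ) = ∑ i, normSq (A i *ᵥ ψ) := by
  simp only [normSq]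
  rw [Finset.sum_comm, Finset.sum_comm (f := fun i x => ‖(A i *ᵥ ψ) x‖ ^ 2)]
  refine Finset.sum_congr rfl fun x _ => ?_
  simp only [rotatedKraus_mulVec_apply]
  exact normSq_mulVec_of_conjTranspose_mul_self (mem_unitaryGroup_iff'.1 hW) _

open Classical in
theorem eventProb_eq_sum_of_rotatedKraus_eq [DecidableEq ι] {W : Matrix ι ι ℂ}
    (hW : W ∈ unitaryGroup ι ℂ) {A : ι → Matrix κ κ ℂ} {S : Set ι}
    (hS : ∀ i ∉ S, rotatedKraus A W i = A i) (ψ : κ → ℂ) :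
    eventProb A W ψ S = ∑ i with i ∈ S, normSq (A i *ᵥ ψ) := by
  have htotal := sum_normSq_rotatedKraus_mulVec hW A ψ
  rw [← Finset.sum_filter_add_sum_filter_not _ (· ∈ S),
    ← Finset.sum_filter_add_sum_filter_not (f := fun i => normSq (A i *ᵥ ψ)) _ (· ∈ S)] at htotal
  have hcompl : ∑ i with i ∉ S, normSq (rotatedKraus A W i *ᵥ ψ)
      = ∑ i with i ∉ S, normSq (A i *ᵥ ψ) :=
    Finset.sum_congr rfl fun i hi => by rw [hS i (Finset.mem_filter.1 hi).2]
  rw [eventProb, ← Finset.sum_filter]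
  linarith

end Born

/-! ### The Kraus operators -/

section Kraus

variable {ℓ : ℕ}

lemma card_pair (ℓ : ℕ) : Fintype.card (Pair ℓ) = ℓ * (2 * ℓ + 1) := by
  have h := card_mul_card_eq_two_mul_card_lt_add_card (ι := Fin (2 * ℓ + 1))
  rw [Fintype.card_fin] at h
  linarith

lemma pairOp_conjTranspose (p : Pair ℓ) : (pairOp p)ᴴ = pairOp p := by
  rw [pairOp, gammaPair, conjTranspose_smul, ← star_eq_conjTranspose,
    isCliffordFamily_gamma.star_bivector p.2.ne]
  simp

lemma pairOp_mul_self (p : Pair ℓ) : pairOp p * pairOp p = 1 := by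
  rw [pairOp, gammaPair, smul_mul_smul_comm, isCliffordFamily_gamma.bivector_mul_self p.2.ne]
  simp

lemma krausNorm_sq (ℓ : ℕ) : krausNorm ℓ ^ 2 = 1 / (ℓ * (2 * ℓ + 1)) := by
  rw [krausNorm, div_pow, one_pow, Real.sq_sqrt (by positivity)]

lemma ofReal_krausNorm_ne_zero (hℓ : 1 ≤ ℓ) : (krausNorm ℓ : ℂ) ≠ 0 := by
  have : (0 : ℝ) < ℓ := Nat.cast_pos.2 hℓ
  exact Complex.ofReal_ne_zero.2 (one_div_ne_zero (by positivity))

lemma normSq_akltTensor_mulVec (p : Pair ℓ) (ψ : Qubits ℓ → ℂ) :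
    normSq (akltTensor ℓ p *ᵥ ψ) = normSq ψ / (ℓ * (2 * ℓ + 1)) := by
  have hunit : (pairOp p)ᴴ * pairOp p = 1 := by rw [pairOp_conjTranspose, pairOp_mul_self]
  rw [akltTensor, smul_mulVec, normSq_smul, normSq_mulVec_of_conjTranspose_mul_self hunit,
    Complex.norm_real, Real.norm_eq_abs, sq_abs, krausNorm_sq, one_div_mul_eq_div]

theorem sum_akltTensor_conjTranspose_mul_self (hℓ : 1 ≤ ℓ) :
    ∑ p, (akltTensor ℓ p)ᴴ * akltTensor ℓ p = 1 := by
  have : (0 : ℝ) < ℓ := Nat.cast_pos.2 hℓ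
  have hterm : ∀ p, (akltTensor ℓ p)ᴴ * akltTensor ℓ p = (krausNorm ℓ ^ 2) • 1 := fun p => by
    rw [akltTensor, conjTranspose_smul, smul_mul_smul_comm, pairOp_conjTranspose, pairOp_mul_self,
      Complex.star_def, Complex.conj_ofReal, ← Complex.ofReal_mul, ← sq, Complex.coe_smul]
  simp only [hterm, Finset.sum_const, Finset.card_univ, card_pair, krausNorm_sq]
  rw [← Nat.cast_smul_eq_nsmul ℝ, smul_smul]
  push_cast
  rw [mul_one_div_cancel (by positivity), one_smul]

lemma mul_akltTensor_injective (hℓ : 1 ≤ ℓ) (p : Pair ℓ) :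
    Function.Injective fun M => akltTensor ℓ p * M := fun M N h => by
  have h : akltTensor ℓ p * M = akltTensor ℓ p * N := h
  rw [akltTensor, smul_mul_assoc, smul_mul_assoc] at h
  have h' := congrArg (pairOp p * ·) (smul_right_injective _ (ofReal_krausNorm_ne_zero hℓ) h)
  simpa only [← mul_assoc, pairOp_mul_self, one_mul] using h'

end Kraus

/-! ### Success probabilities -/

section Success

variable {ℓ : ℕ} {a b : Fin (2 * ℓ + 1)} {p : Pair ℓ}

theorem eventProb_setOf_crosses (hab : a ≠ b) {W : Matrix (Pair ℓ) (Pair ℓ) ℂ}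
    (hW : W ∈ unitaryGroup (Pair ℓ) ℂ)
    (h : ∀ p, ¬Crosses {a, b} p → rotatedKraus (akltTensor ℓ) W p = akltTensor ℓ p)
    {ψ : Qubits ℓ → ℂ} (hψ : normSq ψ = 1) :
    eventProb (akltTensor ℓ) W ψ {p | Crosses {a, b} p} = successProb ℓ := by
  classical
  have hcard := card_crosses ({a, b} : Finset (Fin (2 * ℓ + 1)))
  rw [Finset.card_compl, Finset.card_pair hab, Fintype.card_fin, Fintype.card_subtype] at hcard
  have hℓ : 1 ≤ ℓ := by have := a.2; have := b.2; have := Fin.val_ne_of_ne hab; omega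
  rw [eventProb_eq_sum_of_rotatedKraus_eq (S := {p | Crosses {a, b} p}) hW h]
  simp only [normSq_akltTensor_mulVec, hψ, Finset.sum_const, Set.mem_ofPred_eq]
  rw [hcard, successProb, nsmul_eq_mul, show 2 * ℓ + 1 - 2 = 2 * ℓ - 1 by omega]
  push_cast [show 1 ≤ 2 * ℓ by omega]
  ring

lemma gamma_mul_gamma_mul_pairOp_of_crosses (hab : a ≠ b) (hp : Crosses {a, b} p) :
    gamma ℓ a * gamma ℓ b * pairOp p = -(pairOp p * (gamma ℓ a * gamma ℓ b)) := by
  rw [pairOp, gammaPair, mul_smul_comm, smul_mul_assoc,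
    isCliffordFamily_gamma.bivector_mul_bivector_of_crosses hab hp, smul_neg]

lemma commute_gamma_mul_gamma_pairOp (hab : a ≠ b) (hp : ¬Crosses {a, b} p) :
    Commute (gamma ℓ a * gamma ℓ b) (pairOp p) :=
  (isCliffordFamily_gamma.commute_bivector_bivector_of_not_crosses hab hp).smul_right _

lemma conjTranspose_expGate (hab : a ≠ b) (θ : ℝ) :
    (expGate a b θ : Matrix (Qubits ℓ) (Qubits ℓ) ℂ)ᴴ
      = rotor (gamma ℓ a * gamma ℓ b) (-θ) := by
  rw [expGate_eq_rotor hab, ← star_eq_conjTranspose,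
    star_rotor (isCliffordFamily_gamma.star_bivector hab)]

variable {V : spinGroup ℓ} {θ : ℝ}

lemma rotatedKraus_akltTensor_of_crosses (hab : a ≠ b) (hV : V.1.1 = expGate a b (θ / 2))
    (hp : Crosses {a, b} p) :
    rotatedKraus (akltTensor ℓ) (adjoint (spinHom ℓ V)) p = akltTensor ℓ p * expGate a b θ := by
  rw [rotatedKraus_akltTensor, rotatedKraus_pairOp_spinHom, hV, conjTranspose_expGate hab,
    expGate_eq_rotor hab, expGate_eq_rotor hab, akltTensor, smul_mul_assoc,
    rotor_neg_mul_mul_rotor_of_anticommute (isCliffordFamily_gamma.bivector_mul_self hab)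
      (gamma_mul_gamma_mul_pairOp_of_crosses hab hp)]

lemma rotatedKraus_akltTensor_of_not_crosses (hab : a ≠ b) (hV : V.1.1 = expGate a b θ)
    (hp : ¬Crosses {a, b} p) :
    rotatedKraus (akltTensor ℓ) (adjoint (spinHom ℓ V)) p = akltTensor ℓ p := by
  rw [rotatedKraus_akltTensor, rotatedKraus_pairOp_spinHom, hV, conjTranspose_expGate hab,
    expGate_eq_rotor hab, akltTensor,
    rotor_neg_mul_mul_rotor_of_commute (isCliffordFamily_gamma.bivector_mul_self hab)
      (commute_gamma_mul_gamma_pairOp hab hp)]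

lemma rotatedKraus_eq_akltTensor_mul_expGate_iff_crosses (hℓ : 1 ≤ ℓ) (hab : a ≠ b)
    (hθ : (expGate a b θ : Matrix (Qubits ℓ) (Qubits ℓ) ℂ) ≠ 1)
    (hV : V.1.1 = expGate a b (θ / 2)) :
    rotatedKraus (akltTensor ℓ) (adjoint (spinHom ℓ V)) p = akltTensor ℓ p * expGate a b θ
      ↔ Crosses {a, b} p := by
  refine ⟨fun h => ?_, rotatedKraus_akltTensor_of_crosses hab hV⟩
  by_contra hp
  rw [rotatedKraus_akltTensor_of_not_crosses hab hV hp] at h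
  exact hθ (mul_akltTensor_injective hℓ p (h.symm.trans (mul_one _).symm))

theorem eventProb_expGate (hℓ : 1 ≤ ℓ) (hab : a ≠ b)
    (hθ : (expGate a b θ : Matrix (Qubits ℓ) (Qubits ℓ) ℂ) ≠ 1)
    (hV : V.1.1 = expGate a b (θ / 2)) {ψ : Qubits ℓ → ℂ} (hψ : normSq ψ = 1) :
    eventProb (akltTensor ℓ) (adjoint (spinHom ℓ V)) ψ
      {p | rotatedKraus (akltTensor ℓ) (adjoint (spinHom ℓ V)) p
        = akltTensor ℓ p * expGate a b θ} = successProb ℓ := by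
  simp only [rotatedKraus_eq_akltTensor_mul_expGate_iff_crosses hℓ hab hθ hV]
  exact eventProb_setOf_crosses hab (adjoint_mem_unitaryGroup _)
    (fun p => rotatedKraus_akltTensor_of_not_crosses hab hV) hψ

end Success

/-! ### Projections on the virtual space -/

section Reflection

variable {ι κ : Type} [Fintype ι] [DecidableEq ι]

lemma rotatedKraus_diagonal_mul_add (A : ι → Matrix κ κ ℂ) (T : Matrix ι ι ℂ) (d : ι → ℂ)
    (c t : ℂ) (i : ι) : rotatedKraus A (diagonal d * (c • (1 + t • T))) i
      = d i • c • (A i + t • rotatedKraus A T i) := by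
  simp only [rotatedKraus, diagonal_mul, Matrix.smul_apply, Matrix.add_apply, one_apply,
    smul_eq_mul, mul_smul, add_smul, ite_smul, one_smul, zero_smul, ← Finset.smul_sum,
    Finset.sum_add_distrib, Finset.sum_ite_eq, Finset.mem_univ, if_true]

lemma diagonal_mul_one_add_I_smul_mem_unitaryGroup {T : Matrix ι ι ℂ} (hT : Tᴴ = T)
    (hT' : T * T = 1) {d : ι → ℂ} (hd : ∀ i, d i * star (d i) = 1) :
    diagonal d * (((1 - Complex.I) / 2) • (1 + Complex.I • T)) ∈ unitaryGroup ι ℂ := by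
  refine mul_mem (mem_unitaryGroup_iff.2 ?_) (mem_unitaryGroup_iff.2 ?_)
  · rw [star_eq_conjTranspose, diagonal_conjTranspose, diagonal_mul_diagonal]
    simpa only [Pi.star_apply, hd] using diagonal_one
  · have hscalar : (1 - Complex.I) / 2 * star ((1 - Complex.I) / 2) = (1 / 2 : ℂ) := by
      rw [Complex.star_def, map_div₀, map_sub, map_one, Complex.conj_I, map_ofNat]
      linear_combination -(1 / 4 : ℂ) * Complex.I_mul_I
    have hprod : (1 + Complex.I • T) * (1 + Complex.I • T)ᴴ = (2 : ℂ) • 1 := by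
      rw [conjTranspose_add, conjTranspose_smul, conjTranspose_one, hT, Complex.star_def,
        Complex.conj_I, mul_add, mul_one, add_mul, one_mul, smul_mul_smul_comm, hT', mul_neg,
        Complex.I_mul_I, neg_neg, neg_smul, two_smul, one_smul]
      abel
    rw [star_eq_conjTranspose, conjTranspose_smul, smul_mul_smul_comm, hscalar, hprod, smul_smul,
      one_div_mul_cancel two_ne_zero, one_smul]

/-- `(1 + iT) / √2` is unitary for a reflection `T`; outcomes fixed by `T` up to sign only need
their phase corrected. -/
theorem exists_unitary_rotatedKraus_eq_add_I_smul {T : Matrix ι ι ℂ} (hT : Tᴴ = T)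
    (hT' : T * T = 1) {A : ι → Matrix κ κ ℂ} {S : Set ι}
    (hS : ∀ i ∉ S, rotatedKraus A T i = A i ∨ rotatedKraus A T i = -A i) :
    ∃ W ∈ unitaryGroup ι ℂ,
      (∀ i ∈ S, rotatedKraus A W i
        = ((1 - Complex.I) / 2) • (A i + Complex.I • rotatedKraus A T i)) ∧
      ∀ i ∉ S, rotatedKraus A W i = A i := by
  have hphase : ∀ i, ∃ z : ℂ, z * star z = 1 ∧ (i ∈ S → z = 1) ∧ (i ∉ S →
      z • ((1 - Complex.I) / 2) • (A i + Complex.I • rotatedKraus A T i) = A i) := fun i => by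
    by_cases hi : i ∈ S
    · exact ⟨1, by simp, fun _ => rfl, fun h => absurd hi h⟩
    · rcases hS i hi with h | h
      · refine ⟨1, by simp, fun _ => rfl, fun _ => ?_⟩
        rw [h]
        match_scalars
        linear_combination -(1 / 2 : ℂ) * Complex.I_mul_I
      · refine ⟨Complex.I, by simp, fun h => absurd h hi, fun _ => ?_⟩
        rw [h]
        match_scalars
        linear_combination (Complex.I - 2) / 2 * Complex.I_mul_I
  choose d hd hdS hdS' using hphase
  refine ⟨_, diagonal_mul_one_add_I_smul_mem_unitaryGroup hT hT' hd, fun i hi => ?_,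
    fun i hi => ?_⟩
  · rw [rotatedKraus_diagonal_mul_add, hdS i hi, one_smul]
  · rw [rotatedKraus_diagonal_mul_add, hdS' i hi]

end Reflection

section Swap

variable {ι : Type*} [LinearOrder ι]

section Clifford

variable {A : Type*} [Ring A] [StarRing A] {Γ : ι → A} {a b : ι} {p : {p : ι × ι // p.1 < p.2}}

lemma IsCliffordFamily.apply_swap_of_mem (hΓ : IsCliffordFamily Γ) (hab : a ≠ b) {i : ι}
    (hi : i ∈ ({a, b} : Finset ι)) :
    Γ (Equiv.swap a b i) = Γ i * (Γ a * Γ b) ∨ Γ (Equiv.swap a b i) = -(Γ i * (Γ a * Γ b)) := by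
  rcases Finset.mem_insert.1 hi with rfl | hi
  · left
    rw [Equiv.swap_apply_left, ← mul_assoc, hΓ.mul_self, one_mul]
  · right
    obtain rfl := Finset.mem_singleton.1 hi
    rw [Equiv.swap_apply_right, hΓ.anticomm hab, mul_neg, neg_neg, ← mul_assoc, hΓ.mul_self,
      one_mul]

lemma swap_apply_of_notMem_pair {i : ι} (hi : i ∉ ({a, b} : Finset ι)) :
    Equiv.swap a b i = i := by
  simp only [Finset.mem_insert, Finset.mem_singleton, not_or] at hi
  exact Equiv.swap_apply_of_ne_of_ne hi.1 hi.2

lemma IsCliffordFamily.apply_swap_mul_apply_swap_of_crosses (hΓ : IsCliffordFamily Γ)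
    (hab : a ≠ b) (hp : Crosses {a, b} p) :
    Γ (Equiv.swap a b p.1.1) * Γ (Equiv.swap a b p.1.2) = Γ p.1.1 * Γ p.1.2 * (Γ a * Γ b) ∨
    Γ (Equiv.swap a b p.1.1) * Γ (Equiv.swap a b p.1.2)
      = -(Γ p.1.1 * Γ p.1.2 * (Γ a * Γ b)) := by
  rcases hp with ⟨h₁, h₂⟩ | ⟨h₂, h₁⟩
  · have hcomm : Γ p.1.1 * (Γ a * Γ b) * Γ p.1.2 = Γ p.1.1 * Γ p.1.2 * (Γ a * Γ b) := by
      rw [mul_assoc, (hΓ.commute_bivector_of_notMem h₂).eq, mul_assoc]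
    rw [swap_apply_of_notMem_pair h₂]
    refine (hΓ.apply_swap_of_mem hab h₁).imp (fun h => ?_) fun h => ?_
    · rw [h, hcomm]
    · rw [h, neg_mul, hcomm]
  · rw [swap_apply_of_notMem_pair h₁]
    refine (hΓ.apply_swap_of_mem hab h₂).imp (fun h => ?_) fun h => ?_
    · rw [h, mul_assoc]
    · rw [h, mul_neg, mul_assoc]

lemma IsCliffordFamily.apply_swap_mul_apply_swap_of_not_crosses (hΓ : IsCliffordFamily Γ)
    (hp : ¬Crosses {a, b} p) :
    Γ (Equiv.swap a b p.1.1) * Γ (Equiv.swap a b p.1.2) = Γ p.1.1 * Γ p.1.2 ∨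
    Γ (Equiv.swap a b p.1.1) * Γ (Equiv.swap a b p.1.2) = -(Γ p.1.1 * Γ p.1.2) := by
  have hmem := (not_xor _ _).1 hp
  by_cases h₁ : p.1.1 ∈ ({a, b} : Finset ι)
  · right
    have h₂ := hmem.1 h₁
    have hlt := p.2.ne
    simp only [Finset.mem_insert, Finset.mem_singleton] at h₁ h₂
    rw [← hΓ.anticomm hlt.symm]
    rcases h₁ with h₁ | h₁ <;> rcases h₂ with h₂ | h₂
    · exact absurd (h₁.trans h₂.symm) hlt
    · rw [h₁, h₂, Equiv.swap_apply_left, Equiv.swap_apply_right]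
    · rw [h₁, h₂, Equiv.swap_apply_left, Equiv.swap_apply_right]
    · exact absurd (h₁.trans h₂.symm) hlt
  · left
    rw [swap_apply_of_notMem_pair h₁, swap_apply_of_notMem_pair (mt hmem.2 h₁)]

end Clifford

variable {R : Type*} [CommRing R] (a b : ι)

lemma secondCompound_swap_mul_self [Fintype ι] :
    secondCompound ((Equiv.swap a b).permMatrix R) * secondCompound ((Equiv.swap a b).permMatrix R)
      = 1 := by
  rw [← secondCompound_mul, ← permMatrix_mul, Equiv.swap_mul_self, permMatrix_one,
    secondCompound_one]

lemma secondCompound_swap_conjTranspose [StarRing R] :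
    (secondCompound ((Equiv.swap a b).permMatrix R))ᴴ
      = secondCompound ((Equiv.swap a b).permMatrix R) := by
  rw [← secondCompound_conjTranspose, conjTranspose_permMatrix, Equiv.swap_inv]

end Swap

section Projection

variable {ℓ : ℕ} {a b : Fin (2 * ℓ + 1)} {p : Pair ℓ}

lemma rotatedKraus_pairOp_permMatrix (σ : Equiv.Perm (Fin (2 * ℓ + 1))) (p : Pair ℓ) :
    rotatedKraus pairOp (secondCompound (σ.permMatrix ℂ)) p
      = gammaPair (σ p.1.1) (σ p.1.2) := by
  have hrow : ∀ i, σ.permMatrix ℂ i = Pi.single (σ i) 1 := fun i => by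
    ext j
    simp [Equiv.Perm.permMatrix, PEquiv.toMatrix_apply, Equiv.toPEquiv_apply, Pi.single_apply,
      eq_comm]
  have horth : σ.permMatrix ℂ p.1.1 ⬝ᵥ σ.permMatrix ℂ p.1.2 = 0 := by
    rw [hrow, hrow, single_one_dotProduct, Pi.single_eq_of_ne (σ.injective.ne p.2.ne)]
  have h := sum_smul_mul_sum_smul_eq_sum_secondCompound_smul (isCliffordFamily_gamma (ℓ := ℓ)) horth
  simp only [hrow, Pi.single_apply, ite_smul, one_smul, zero_smul, Finset.sum_ite_eq',
    Finset.mem_univ, if_true] at h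
  simp only [rotatedKraus, gammaPair, pairOp, h, Finset.smul_sum]
  exact Finset.sum_congr rfl fun q _ => smul_comm _ _ _

lemma rotatedKraus_akltTensor_swap_of_crosses (hab : a ≠ b) (hp : Crosses {a, b} p) :
    ∃ ε : ℂ, (ε = 1 ∨ ε = -1) ∧
      rotatedKraus (akltTensor ℓ) (secondCompound ((Equiv.swap a b).permMatrix ℂ)) p
        = (-Complex.I * ε) • (akltTensor ℓ p * gammaPair a b) := by
  rw [rotatedKraus_akltTensor, rotatedKraus_pairOp_permMatrix]
  rcases isCliffordFamily_gamma.apply_swap_mul_apply_swap_of_crosses hab hp with h | h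
  · refine ⟨-1, .inr rfl, ?_⟩
    rw [gammaPair, h, akltTensor, pairOp, gammaPair, gammaPair]
    simp only [smul_mul_assoc, mul_smul_comm, smul_smul]
    congr 1
    linear_combination -((krausNorm ℓ : ℂ) * Complex.I) * Complex.I_mul_I
  · refine ⟨1, .inl rfl, ?_⟩
    rw [gammaPair, h, akltTensor, pairOp, gammaPair, gammaPair]
    simp only [smul_mul_assoc, mul_smul_comm, smul_smul, smul_neg, ← neg_smul]
    congr 1
    linear_combination ((krausNorm ℓ : ℂ) * Complex.I) * Complex.I_mul_I

lemma rotatedKraus_akltTensor_swap_of_not_crosses (hp : ¬Crosses {a, b} p) :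
    rotatedKraus (akltTensor ℓ) (secondCompound ((Equiv.swap a b).permMatrix ℂ)) p
        = akltTensor ℓ p ∨
    rotatedKraus (akltTensor ℓ) (secondCompound ((Equiv.swap a b).permMatrix ℂ)) p
        = -akltTensor ℓ p := by
  rw [rotatedKraus_akltTensor, rotatedKraus_pairOp_permMatrix]
  refine (isCliffordFamily_gamma.apply_swap_mul_apply_swap_of_not_crosses hp).imp
    (fun h => ?_) fun h => ?_
  · rw [gammaPair, h, akltTensor, pairOp, gammaPair]
  · rw [gammaPair, h, akltTensor, pairOp, gammaPair, smul_neg, smul_neg]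

theorem exists_unitary_rotatedKraus_eq_projector (hℓ : 1 ≤ ℓ) (hab : a ≠ b) :
    ∃ W ∈ unitaryGroup (Pair ℓ) ℂ,
      (∀ p, Crosses {a, b} p → ∃ c ε : ℂ, c ≠ 0 ∧ (ε = 1 ∨ ε = -1) ∧
        rotatedKraus (akltTensor ℓ) W p
          = c • (pairOp p * ((1 / 2 : ℂ) • (1 + ε • gammaPair a b)))) ∧
      ∀ p, ¬Crosses {a, b} p → rotatedKraus (akltTensor ℓ) W p = akltTensor ℓ p := by
  obtain ⟨W, hW, hcross, hnot⟩ := exists_unitary_rotatedKraus_eq_add_I_smul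
    (secondCompound_swap_conjTranspose a b) (secondCompound_swap_mul_self a b)
    (S := {p | Crosses {a, b} p}) fun p => rotatedKraus_akltTensor_swap_of_not_crosses
  refine ⟨W, hW, fun p hp => ?_, hnot⟩
  obtain ⟨ε, hε, h⟩ := rotatedKraus_akltTensor_swap_of_crosses hab hp
  refine ⟨krausNorm ℓ * (1 - Complex.I), ε, mul_ne_zero (ofReal_krausNorm_ne_zero hℓ)
    (sub_ne_zero.2 fun h => by simpa using congrArg Complex.im h), hε, ?_⟩
  rw [hcross p hp, h, smul_smul, ← mul_assoc, mul_neg, Complex.I_mul_I, neg_neg, one_mul,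
    akltTensor, mul_smul_comm, mul_add, mul_one, mul_smul_comm, smul_mul_assoc]
  module

end Projection

/-! ### Induced gates -/

section Measurement

lemma eq_of_star_dotProduct_mulVec_eq {κ : Type*} [Fintype κ] {M N : Matrix κ κ ℂ}
    (h : ∀ R L : κ → ℂ, star R ⬝ᵥ (M *ᵥ L) = star R ⬝ᵥ (N *ᵥ L)) : M = N := by
  classical
  ext x y
  simpa using h (Pi.single x 1) (Pi.single y 1)

variable {ι κ : Type} [Fintype κ] [DecidableEq κ] {n : ℕ}

lemma measuredAmplitude_mpsState [Fintype ι] (A : ι → Matrix κ κ ℂ) (W : Fin n → Matrix ι ι ℂ)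
    (i : Fin n → ι) (R L : κ → ℂ) : measuredAmplitude W i (mpsState A n R L)
      = star R ⬝ᵥ ((List.ofFn fun k => rotatedKraus A (W k) (i k)).prod *ᵥ L) := by
  classical
  have h := (MultilinearMap.mkPiAlgebraFin ℂ n (Matrix κ κ ℂ)).map_sum
    fun k (j : ι) => W k (i k) j • A j
  simp only [MultilinearMap.map_smul_univ, MultilinearMap.mkPiAlgebraFin_apply] at h
  simp only [rotatedKraus, h, measuredAmplitude, mpsState, sum_mulVec, dotProduct_sum, smul_mulVec,
    dotProduct_smul, smul_eq_mul]

lemma prod_ofFn_smul (c : ℂ) (M : Fin n → Matrix κ κ ℂ) :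
    (List.ofFn fun k => c • M k).prod = c ^ n • (List.ofFn M).prod := by
  simpa [MultilinearMap.mkPiAlgebraFin_apply] using
    (MultilinearMap.mkPiAlgebraFin ℂ n (Matrix κ κ ℂ)).map_smul_univ (fun _ => c) M

lemma exists_prod_ofFn_eq_pow_smul {H : Subgroup (unitaryGroup κ ℂ)} {c : ℂ}
    {M : Fin n → Matrix κ κ ℂ} (h : ∀ k, ∃ U ∈ H, M k = c • U.1) :
    ∃ U ∈ H, (List.ofFn M).prod = c ^ n • U.1 := by
  choose U hU hM using h
  refine ⟨(List.ofFn U).prod, Subgroup.list_prod_mem _ fun V hV => ?_, ?_⟩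
  · obtain ⟨k, rfl⟩ := List.mem_ofFn.1 hV
    exact hU k
  · rw [funext hM, prod_ofFn_smul]
    exact congrArg (c ^ n • ·) (by simp [List.map_ofFn, Function.comp_def])

end Measurement

section InducedGates

variable {ℓ n : ℕ} {g : Fin n → SO ℓ} {i : Fin n → Pair ℓ} {a b : Fin (2 * ℓ + 1)}
  {G G' : Matrix (Qubits ℓ) (Qubits ℓ) ℂ}

lemma induces_iff (hℓ : 1 ≤ ℓ) : Induces g i G ↔
    (List.ofFn fun k => rotatedKraus pairOp (adjoint (g k)) (i k)).prod = byproduct i * G := by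
  have hamp : ∀ R L, measuredAmplitude (fun k => adjoint (g k)) i (akltState ℓ n R L)
      = (krausNorm ℓ : ℂ) ^ n * (star R ⬝ᵥ
        ((List.ofFn fun k => rotatedKraus pairOp (adjoint (g k)) (i k)).prod *ᵥ L)) :=
    fun R L => by
      simp only [akltState, measuredAmplitude_mpsState, rotatedKraus_akltTensor]
      rw [prod_ofFn_smul, smul_mulVec, dotProduct_smul, smul_eq_mul]
  have hnorm := pow_ne_zero n (ofReal_krausNorm_ne_zero hℓ)
  simp only [Induces, hamp, mul_right_inj' hnorm]
  exact ⟨eq_of_star_dotProduct_mulVec_eq, fun h _ _ => by rw [h]⟩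

lemma isUnit_byproduct (i : Fin n → Pair ℓ) : IsUnit (byproduct i) :=
  List.prod_isUnit fun _ hM => by
    obtain ⟨k, rfl⟩ := List.mem_ofFn.1 hM
    exact IsUnit.of_mul_eq_one _ (pairOp_mul_self (i k))

lemma Induces.unique (hℓ : 1 ≤ ℓ) (h : Induces g i G) (h' : Induces g i G') : G = G' :=
  (isUnit_byproduct i).mul_left_cancel <|
    ((induces_iff hℓ).1 h).symm.trans ((induces_iff hℓ).1 h')

lemma expGate_neg_pi_div_two (hab : a ≠ b) :
    expGate a b (-(Real.pi / 2)) = gamma ℓ a * gamma ℓ b := by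
  rw [expGate_eq_rotor hab, rotor, Real.cos_neg, Real.sin_neg, Real.cos_pi_div_two,
    Real.sin_pi_div_two, zero_smul, neg_one_smul, zero_sub, neg_neg]

lemma exists_mem_spinGroup_pairOp_eq (p : Pair ℓ) :
    ∃ U ∈ spinGroup ℓ, pairOp p = -Complex.I • U.1 := by
  obtain ⟨U, hU, hU'⟩ := exists_mem_spinGroup_eq_expGate p.2.ne (-(Real.pi / 2))
  exact ⟨U, hU, by rw [hU', expGate_neg_pi_div_two p.2.ne, pairOp, gammaPair]⟩

lemma exists_mem_spinGroup_rotatedKraus_pairOp_eq (g : SO ℓ) (p : Pair ℓ) :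
    ∃ U ∈ spinGroup ℓ, rotatedKraus pairOp (adjoint g) p = -Complex.I • U.1 := by
  obtain ⟨V, rfl⟩ := rotorHom_surjective isCliffordFamily_gamma g
  obtain ⟨U, hU, hU'⟩ := exists_mem_spinGroup_pairOp_eq p
  refine ⟨V.1⁻¹ * U * V.1, mul_mem (mul_mem (inv_mem V.2) hU) V.2, ?_⟩
  rw [rotatedKraus_pairOp_spinHom, hU', mul_smul_comm, smul_mul_assoc]
  rfl

theorem exists_mem_spinGroup_induces (hℓ : 1 ≤ ℓ) (g : Fin n → SO ℓ) (i : Fin n → Pair ℓ) :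
    ∃ V ∈ spinGroup ℓ, Induces g i V.1 := by
  obtain ⟨B, hB, hB'⟩ := exists_prod_ofFn_eq_pow_smul fun k => exists_mem_spinGroup_pairOp_eq (i k)
  obtain ⟨U, hU, hU'⟩ := exists_prod_ofFn_eq_pow_smul fun k =>
    exists_mem_spinGroup_rotatedKraus_pairOp_eq (g k) (i k)
  refine ⟨B⁻¹ * U, mul_mem (inv_mem hB) hU, (induces_iff hℓ).2 ?_⟩
  have hcancel : B.1 * (B⁻¹ * U).1 = U.1 := congrArg Subtype.val (mul_inv_cancel_left B U)
  rw [hU', byproduct, hB', smul_mul_assoc, hcancel]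

lemma exists_expGate_mul_pairOp (hab : a ≠ b) (θ : ℝ) (p : Pair ℓ) :
    ∃ η, expGate a b η * pairOp p = pairOp p * expGate a b θ := by
  rw [expGate_eq_rotor hab θ]
  by_cases hp : Crosses {a, b} p
  · exact ⟨-θ, by rw [expGate_eq_rotor hab, rotor_neg_mul_of_anticommute
      (gamma_mul_gamma_mul_pairOp_of_crosses hab hp)]⟩
  · exact ⟨θ, by rw [expGate_eq_rotor hab, rotor_mul_of_commute
      (commute_gamma_mul_gamma_pairOp hab hp)]⟩

lemma byproduct_cons (p : Pair ℓ) (i : Fin n → Pair ℓ) :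
    byproduct (Fin.cons p i : Fin (n + 1) → Pair ℓ) = pairOp p * byproduct i := by
  simp only [byproduct, List.ofFn_succ, Fin.cons_zero, Fin.cons_succ, List.prod_cons]

lemma exists_expGate_mul_byproduct (hab : a ≠ b) (i : Fin n → Pair ℓ) (θ : ℝ) :
    ∃ η, expGate a b η * byproduct i = byproduct i * expGate a b θ := by
  induction i using Fin.consInduction with
  | elim0 => exact ⟨θ, by simp [byproduct]⟩
  | cons p i ih =>
    obtain ⟨η, hη⟩ := ih
    obtain ⟨ζ, hζ⟩ := exists_expGate_mul_pairOp hab η p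
    exact ⟨ζ, by rw [byproduct_cons, ← mul_assoc, hζ, mul_assoc, hη, mul_assoc]⟩

lemma exists_crosses (hℓ : 1 ≤ ℓ) (hab : a ≠ b) : ∃ p : Pair ℓ, Crosses {a, b} p := by
  classical
  have hcard := card_crosses ({a, b} : Finset (Fin (2 * ℓ + 1)))
  rw [Finset.card_compl, Finset.card_pair hab, Fintype.card_fin] at hcard
  have hpos : 0 < Fintype.card {p : Pair ℓ // Crosses {a, b} p} := by
    rw [hcard]
    omega
  obtain ⟨p, hp⟩ := Fintype.card_pos_iff.1 hpos
  exact ⟨p, hp⟩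

lemma expGate_mul_mem_inducedGates (hℓ : 1 ≤ ℓ) (hab : a ≠ b) (θ : ℝ)
    (hG : G ∈ inducedGates ℓ) : expGate a b θ * G ∈ inducedGates ℓ := by
  obtain ⟨n, g, i, h⟩ := hG
  obtain ⟨p, hp⟩ := exists_crosses hℓ hab
  obtain ⟨η, hη⟩ := exists_expGate_mul_byproduct hab i θ
  obtain ⟨V, hV, hV'⟩ := exists_mem_spinGroup_eq_expGate hab (η / 2)
  refine ⟨n + 1, Fin.cons (spinHom ℓ ⟨V, hV⟩) g, Fin.cons p i, (induces_iff hℓ).2 ?_⟩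
  simp only [List.ofFn_succ, List.prod_cons, byproduct_cons, Fin.cons_zero, Fin.cons_succ]
  have hsite : rotatedKraus pairOp (adjoint (spinHom ℓ ⟨V, hV⟩)) p = pairOp p * expGate a b η := by
    have h := rotatedKraus_akltTensor_of_crosses (V := ⟨V, hV⟩) hab hV' hp
    rw [rotatedKraus_akltTensor, akltTensor, smul_mul_assoc] at h
    exact smul_right_injective _ (ofReal_krausNorm_ne_zero hℓ) h
  rw [(induces_iff hℓ).1 h, hsite, mul_assoc, ← mul_assoc (expGate a b η), hη]
  simp only [mul_assoc]

lemma one_mem_inducedGates (hℓ : 1 ≤ ℓ) :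
    (1 : Matrix (Qubits ℓ) (Qubits ℓ) ℂ) ∈ inducedGates ℓ :=
  ⟨0, Fin.elim0, Fin.elim0, (induces_iff hℓ).2 (by simp [byproduct])⟩

lemma mem_inducedGates_of_mem_spinGroup (hℓ : 1 ≤ ℓ) {V : unitaryGroup (Qubits ℓ) ℂ}
    (hV : V ∈ spinGroup ℓ) : V.1 ∈ inducedGates ℓ := by
  induction hV using Subgroup.closure_induction_left with
  | one => exact one_mem_inducedGates hℓ
  | mul_left V hV W _ hW =>
    obtain ⟨a, b, hab, θ, hVθ⟩ := hV
    have h := expGate_mul_mem_inducedGates hℓ hab θ hW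
    rwa [expGate_eq_rotor hab, ← hVθ] at h
  | inv_mul_cancel V hV W _ hW =>
    obtain ⟨a, b, hab, θ, hVθ⟩ := hV
    have h := expGate_mul_mem_inducedGates hℓ hab (-θ) hW
    rwa [expGate_eq_rotor hab, ← star_rotor (isCliffordFamily_gamma.star_bivector hab), ← hVθ] at h

theorem setOf_coe_mem_spinGroup_eq_inducedGates (hℓ : 1 ≤ ℓ) :
    {G : Matrix (Qubits ℓ) (Qubits ℓ) ℂ | ∃ V ∈ spinGroup ℓ, V.1 = G} = inducedGates ℓ := by
  refine Set.Subset.antisymm ?_ ?_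
  · rintro _ ⟨V, hV, rfl⟩
    exact mem_inducedGates_of_mem_spinGroup hℓ hV
  · rintro G ⟨n, g, i, h⟩
    obtain ⟨V, hV, hV'⟩ := exists_mem_spinGroup_induces hℓ g i
    exact ⟨V, hV, hV'.unique hℓ h⟩

lemma gammaProducts_subset_inducedGates (hℓ : 1 ≤ ℓ) : gammaProducts ℓ ⊆ inducedGates ℓ := by
  rintro _ ⟨a, b, rfl⟩
  by_cases hab : a = b
  · rw [hab, isCliffordFamily_gamma.mul_self]
    exact one_mem_inducedGates hℓ
  · rw [← expGate_neg_pi_div_two hab, ← mul_one (expGate a b _)]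
    exact expGate_mul_mem_inducedGates hℓ hab _ (one_mem_inducedGates hℓ)

theorem actsIrreducibly_inducedGates (hℓ : 1 ≤ ℓ) : ActsIrreducibly (inducedGates ℓ) :=
  (actsIrreducibly_of_adjoin_eq_top (adjoin_gammaProducts ℓ)).mono
    (gammaProducts_subset_inducedGates hℓ)

end InducedGates

end AKLT

end

open AKLT Matrix in
theorem mainTheorem5 (ℓ : ℕ) (hℓ : 1 ≤ ℓ) :
    -- dimensions and normalization of the matrix product state
    Fintype.card (Pair ℓ) = ℓ * (2 * ℓ + 1) ∧
    Fintype.card (Qubits ℓ) = 2 ^ ℓ ∧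
    ∑ p, (akltTensor ℓ p)ᴴ * akltTensor ℓ p = 1 ∧
    -- the on-site space carries an irreducible unitary representation of `SO(2ℓ+1)`
    (∃ ρ : SO ℓ →* unitaryGroup (Pair ℓ) ℂ, ∀ g, (ρ g : Matrix (Pair ℓ) (Pair ℓ) ℂ) = adjoint g) ∧
    ActsIrreducibly (Set.range (adjoint (ℓ := ℓ))) ∧
    -- the induced gates form a group `𝒢`, which acts irreducibly on the virtual space
    (∃ 𝒢 : Subgroup (unitaryGroup (Qubits ℓ) ℂ),
      {G : Matrix (Qubits ℓ) (Qubits ℓ) ℂ | ∃ V ∈ 𝒢, (V : Matrix (Qubits ℓ) (Qubits ℓ) ℂ) = G}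
        = inducedGates ℓ ∧
      (∀ (n : ℕ) (g : Fin n → SO ℓ) (i : Fin n → Pair ℓ), ∃ V ∈ 𝒢, Induces g i V.1) ∧
      𝒢 = Subgroup.closure {V | ∃ a b, a ≠ b ∧ ∃ θ : ℝ, V.1 = expGate a b θ} ∧
      ActsIrreducibly (inducedGates ℓ) ∧
      -- modulo global phases it is `SO(2ℓ+1)`, through the symmetry condition
      ∃ π : 𝒢 →* SO ℓ,
        Function.Surjective π ∧
        Topology.IsQuotientMap π ∧
        (∀ V : 𝒢, π V = 1 ↔
          ∃ c : ℂ, (V.1 : Matrix (Qubits ℓ) (Qubits ℓ) ℂ) = c • (1 : Matrix _ _ ℂ)) ∧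
        (∀ V : 𝒢, π V = 1 ↔
          (V.1 : Matrix (Qubits ℓ) (Qubits ℓ) ℂ) = 1 ∨
          (V.1 : Matrix (Qubits ℓ) (Qubits ℓ) ℂ) = -1) ∧
        (∀ (V : 𝒢) (p : Pair ℓ),
          rotatedKraus (akltTensor ℓ) (adjoint (π V)) p
            = (V.1 : Matrix (Qubits ℓ) (Qubits ℓ) ℂ)ᴴ * akltTensor ℓ p * V.1) ∧
        -- success probability of every nontrivial elementary gate `exp(-iθΓ^{ab})`
        (∀ a b : Fin (2 * ℓ + 1), a ≠ b → ∀ θ : ℝ,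
          (¬ ∃ c : ℂ, expGate a b θ = c • (1 : Matrix (Qubits ℓ) (Qubits ℓ) ℂ)) →
          ∃ V : 𝒢, (V.1 : Matrix (Qubits ℓ) (Qubits ℓ) ℂ) = expGate a b (θ / 2) ∧
            (∀ p : Pair ℓ,
              rotatedKraus (akltTensor ℓ) (adjoint (π V)) p = akltTensor ℓ p * expGate a b θ ∨
              rotatedKraus (akltTensor ℓ) (adjoint (π V)) p = akltTensor ℓ p) ∧
            ∀ ψ : Qubits ℓ → ℂ, normSq ψ = 1 →
              eventProb (akltTensor ℓ) (adjoint (π V)) ψ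
                {p | rotatedKraus (akltTensor ℓ) (adjoint (π V)) p
                  = akltTensor ℓ p * expGate a b θ} = successProb ℓ)) ∧
    -- success probability of the projections onto the eigenspaces of `Γ^{ab}`
    (∀ a b : Fin (2 * ℓ + 1), a ≠ b →
      ∃ W ∈ unitaryGroup (Pair ℓ) ℂ, ∃ S : Set (Pair ℓ),
        (∀ p ∈ S, ∃ (c : ℂ) (B : Matrix (Qubits ℓ) (Qubits ℓ) ℂ) (ε : ℂ),
          c ≠ 0 ∧ IsPauliOp B ∧ (ε = 1 ∨ ε = -1) ∧
          rotatedKraus (akltTensor ℓ) W p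
            = c • (B * ((1 / 2 : ℂ) • (1 + ε • gammaPair a b)))) ∧
        (∀ p ∉ S, rotatedKraus (akltTensor ℓ) W p = akltTensor ℓ p) ∧
        ∀ ψ : Qubits ℓ → ℂ, normSq ψ = 1 →
          eventProb (akltTensor ℓ) W ψ S = successProb ℓ) ∧
    -- the byproducts `Γ^a Γ^b` and their products are tensor products of Pauli operators
    (∀ a b : Fin (2 * ℓ + 1), a ≠ b → IsPauliOp (gamma ℓ a * gamma ℓ b)) ∧
    (∀ (n : ℕ) (i : Fin n → Pair ℓ), IsPauliOp (byproduct i)) := by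
  refine ⟨card_pair ℓ, by simp, sum_akltTensor_conjTranspose_mul_self hℓ,
    ⟨adjointHom ℓ, fun _ => rfl⟩, actsIrreducibly_range_adjoint hℓ,
    ⟨spinGroup ℓ, setOf_coe_mem_spinGroup_eq_inducedGates hℓ,
      fun _ => exists_mem_spinGroup_induces hℓ, closure_expGate_eq_rotorGroup.symm,
      actsIrreducibly_inducedGates hℓ, spinHom ℓ, rotorHom_surjective isCliffordFamily_gamma,
      isQuotientMap_spinHom hℓ, fun _ => spinHom_eq_one_iff_exists_smul,
      fun _ => spinHom_eq_one_iff, rotatedKraus_akltTensor_spinHom, fun a b hab θ hθ => ?_⟩,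
    fun a b hab => ?_, fun a b _ => isPauliOp_gamma_mul_gamma a b, fun _ => isPauliOp_byproduct⟩
  · obtain ⟨V, hV, hVθ⟩ := exists_mem_spinGroup_eq_expGate hab (θ / 2)
    have hone : (expGate a b θ : Matrix (Qubits ℓ) (Qubits ℓ) ℂ) ≠ 1 :=
      fun h => hθ ⟨1, by rw [h, one_smul]⟩
    refine ⟨⟨V, hV⟩, hVθ, fun p => ?_, fun ψ hψ => eventProb_expGate hℓ hab hone hVθ hψ⟩
    exact (em (Crosses {a, b} p)).imp (rotatedKraus_akltTensor_of_crosses hab hVθ)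
      (rotatedKraus_akltTensor_of_not_crosses hab hVθ)
  · obtain ⟨W, hW, hcross, hnot⟩ := exists_unitary_rotatedKraus_eq_projector hℓ hab
    refine ⟨W, hW, {p | Crosses {a, b} p}, fun p hp => ?_, hnot,
      fun ψ hψ => eventProb_setOf_crosses hab hW hnot hψ⟩
    obtain ⟨c, ε, hc, hε, h⟩ := hcross p hp
    exact ⟨c, pairOp p, ε, hc, isPauliOp_pairOp p, hε, h⟩
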